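/- Let $\mathfrak g$ be a simply-laced simple Lie algebra over $\mathbb C$ (finite-dimensional), with Cartan subalgebra $\mathfrak h$, a fixed set of simple roots, and $\mathfrak n_+=\bigoplus_{\alpha>0}\mathfrak g_\alpha$. Let $\theta$ be the highest root and $\theta^\vee\in\mathfrak h$ the corresponding coroot (equivalently, since $\mathfrak g$ is simply laced, the image of $\theta$ under the isomorphism $\mathfrak h^*\cong\mathfrak h$ given by the normalized invariant form), and put $\mathfrak g_i=\{x\in\mathfrak g : [\theta^\vee,x]=ix\}$. Let $\eta_0\in\mathfrak g_0\cap\mathfrak n_+$, $\eta_1\in\mathfrak g_1$, $\eta_2\in\mathfrak g_2$ (equivalently, $\eta=\eta_0+\eta_1+\eta_2\in\mathfrak n_+$ with components $\eta_i\in\mathfrak g_i$), and consider the connection $$\mathcal L=\partial_x+\frac{R}{x}+a+bx+O(x^2),\qquad R=-\theta^\vee+\eta_0+\eta_1+\eta_2,$$ where $a,b\in\mathfrak g$ and $a+bx+O(x^2)$ is a $\mathfrak g$-valued function holomorphic near $x=0$. Say that $\mathcal L$ has trivial monodromy at $x=0$ if, for every finite-dimensional $\mathfrak g$-module $V$, analytic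 continuation once around $0$ of any $V$-valued solution of $\mathcal L\psi=0$ returns the same solution. Then $\mathcal L$ has trivial monodromy at $x=0$ if and only if $$\eta_0=0,\qquad \pi^R_{-1}(a)=0,\qquad \pi^R_{-2}(b)=[\pi^R_{-2}(a),\pi^R_0(a)],$$ where $\pi^R_i$ denotes the projection of $\mathfrak g$ onto $\mathfrak g_i(R)=\{x\in\mathfrak g : [-\theta^\vee+\eta_1+\eta_2,x]=ix\}$ along the sum of the other eigenspaces of $\operatorname{ad}(-\theta^\vee+\eta_1+\eta_2)$. -/

import Mathlib

namespace ZeroMonodromy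

/-! ### Lie-theoretic data -/

section LieTheory

open LieAlgebra LieAlgebra.IsKilling

variable {𝔤 : Type*} [LieRing 𝔤] [LieAlgebra ℂ 𝔤]

/-- The eigenspace `{x ∈ 𝔤 | [S, x] = c x}` of `ad S`. -/
def adEigenspace (S : 𝔤) (c : ℂ) : Submodule ℂ 𝔤 where
  carrier := {x | ⁅S, x⁆ = c • x}
  add_mem' := by
    intro x y hx hy
    simp only [Set.mem_ofPred_eq] at hx hy ⊢
    rw [lie_add, hx, hy, smul_add]
  zero_mem' := by simp
  smul_mem' := by
    intro k x hx
    simp only [Set.mem_ofPred_eq] at hx ⊢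
    rw [lie_smul, hx, smul_comm]

open Classical in
/-- The eigenprojection of `𝔤` onto the `c`-eigenspace of `ad S`, along the sum of all the other
eigenspaces of `ad S`. It is meaningful when `ad S` is diagonalizable, since then these two
subspaces are complementary; it is given the value `0` when they are not complementary. -/
noncomputable def adEigenProj (S : 𝔤) (c : ℂ) : 𝔤 →ₗ[ℂ] 𝔤 :=
  if h : IsCompl (adEigenspace S c) (⨆ d : {d : ℂ // d ≠ c}, adEigenspace S (d : ℂ)) then
    (adEigenspace S c).projection _ h
  else 0

/-- A root pairing is simply laced: all entries of the (generalized) Cartan matrix are symmetric,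
`⟨α, β^∨⟩ = ⟨β, α^∨⟩` for all roots `α`, `β`. For an irreducible reduced root system this says that
all roots have the same length. -/
def IsSimplyLaced {ι R M N : Type*} [CommRing R] [AddCommGroup M] [Module R M]
    [AddCommGroup N] [Module R N] (P : RootPairing ι R M N) : Prop :=
  ∀ i j, P.pairing i j = P.pairing j i

/-- `θ` is the highest root with respect to the base `B`: for every root `α`, the difference
`θ - α` is a sum of simple roots. -/
def IsHighestRoot {ι R M N : Type*} [CommRing R] [AddCommGroup M] [Module R M]
    [AddCommGroup N] [Module R N] {P : RootPairing ι R M N} (B : P.Base) (θ : ι) : Prop :=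
  ∀ i, P.root θ - P.root i ∈ AddSubmonoid.closure (P.root '' B.support)

variable [FiniteDimensional ℂ 𝔤] [IsKilling ℂ 𝔤]

/-- The nilpotent subalgebra `𝔫₊ = ⨁_{α > 0} 𝔤_α` (as a subspace of `𝔤`). -/
noncomputable def nPlus {H : LieSubalgebra ℂ 𝔤} [H.IsCartanSubalgebra]
    (B : (rootSystem H).Base) : Submodule ℂ 𝔤 :=
  ⨆ i : {i : H.root // B.IsPos i}, (rootSpace H (i.1.1 : H → ℂ)).toSubmodule

end LieTheory

/-! ### Monodromy at a regular singular point

All vector spaces below are finite-dimensional over `ℂ`; holomorphy of a vector-valued function is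
expressed through its coordinates, that is, through its composition with all linear functionals. -/

section Monodromy

/-- A function with values in a finite-dimensional space is holomorphic near `x`. -/
def HolomorphicAt {E : Type*} [AddCommGroup E] [Module ℂ E] (A : ℂ → E) (x : ℂ) : Prop :=
  ∀ ℓ : Module.Dual ℂ E, AnalyticAt ℂ (fun y => ℓ (A y)) x

/-- A function with values in a finite-dimensional space has the complex derivative `v` at `x`. -/
def HasVecDerivAt {E : Type*} [AddCommGroup E] [Module ℂ E] (f : ℂ → E) (v : E) (x : ℂ) : Prop :=
  ∀ ℓ : Module.Dual ℂ E, HasDerivAt (fun y => ℓ (f y)) (ℓ v) x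

variable {𝔤 : Type*} [LieRing 𝔤] [LieAlgebra ℂ 𝔤]

/-- `Ψ` is a multivalued solution `ψ(x) = Ψ(log x)`, on the punctured disc `0 < |x| < r`, of the
equation `ψ' + (R / x) ψ + A(x) ψ = 0` in the `𝔤`-module `V`. It is a function of `t = log x`, that
is, a function on the universal covering `{t | |e^t| < r}`, `x = e^t`, of the punctured disc. -/
def IsMultivaluedSolution (R : 𝔤) (A : ℂ → 𝔤) (r : ℝ) {V : Type*} [AddCommGroup V] [Module ℂ V]
    [LieRingModule 𝔤 V] (Ψ : ℂ → V) : Prop :=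
  ∀ t : ℂ, ‖Complex.exp t‖ < r →
    HasVecDerivAt Ψ
      (Complex.exp t • -((Complex.exp t)⁻¹ • ⁅R, Ψ t⁆ + ⁅A (Complex.exp t), Ψ t⁆)) t

/-- The equation `(∂ₓ + R / x + A(x)) ψ = 0` in the `𝔤`-module `V` has trivial monodromy at `0`:
analytic continuation of a solution once around `0`, which is the translation `t ↦ t + 2πi` on the
universal covering of a small punctured disc, gives back the same solution. -/
def HasTrivialMonodromyIn (R : 𝔤) (A : ℂ → 𝔤) (V : Type*) [AddCommGroup V] [Module ℂ V]
    [LieRingModule 𝔤 V] : Prop :=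
  ∃ r : ℝ, 0 < r ∧ (∀ x : ℂ, ‖x‖ < r → HolomorphicAt A x) ∧
    ∀ Ψ : ℂ → V, IsMultivaluedSolution R A r Ψ →
      ∀ t : ℂ, ‖Complex.exp t‖ < r → Ψ (t + 2 * Real.pi * Complex.I) = Ψ t

end Monodromy

/-- The connection `∂ₓ + R / x + A(x)` has trivial monodromy at `0`: it does so in every
finite-dimensional `𝔤`-module. -/
def HasTrivialMonodromy.{u} {𝔤 : Type u} [LieRing 𝔤] [LieAlgebra ℂ 𝔤] (R : 𝔤) (A : ℂ → 𝔤) :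
    Prop :=
  ∀ (V : Type u) [AddCommGroup V] [Module ℂ V] [FiniteDimensional ℂ V]
    [LieRingModule 𝔤 V] [LieModule ℂ 𝔤 V], HasTrivialMonodromyIn R A V

end ZeroMonodromy

namespace ZeroMonodromy

/-! Write S = θ^∨, so that the residue is R = -S + η₀ + η₁ + η₂. Simple lacing forces `ad S` to have
eigenvalues in {-2, ..., 2}, with 𝔤₂ the root line of θ. The nilpotent η₀ acts on this line by a
nilpotent scalar, hence by zero. Therefore an automorphism σ = exp(ad n), with n in 𝔤₁ + 𝔤₂, carries
-S + η₀ to R (`exists_conj_residue`), and R = D + N with D = σ(-S), N = σ(η₀). Here D is graded like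
-S, and N is `ad`-nilpotent, commutes with D and kills 𝔤₋₂(D).

Since D is the semisimple element of an sl₂-triple, it acts diagonalizably with integral eigenvalues
in every finite-dimensional module (`slTwo_iSup_eigenspace_intCast`), so x^D is single-valued.
Applying x^D removes D from the residue and multiplies the degree c part of A by x^c. This leaves a
double pole with coefficient α = π₋₂(a), which exp(-x⁻¹α) removes. The new connection has at most a
simple pole, with residue Q = N + π₋₁(a) + π₋₂(b) - [π₋₂(a), π₀(a)] (`exists_gauge`), and its
monodromy is trivial exactly when the original one is (`allPeriodic_gauge_iff`).

Q is `ad`-nilpotent, so there is no resonance and Frobenius' method applies: a nonzero nilpotent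
residue produces a logarithm in some solution (`eq_zero_of_allPeriodic`), while a zero residue gives
an ordinary point (`exists_allPeriodic`). The adjoint module suffices to force Q = 0, the center
being zero. Finally Q = 0 splits into its components of degrees 0, -1, -2, which are the three
conditions; once η₀ = 0, D is the element that defines the projections. -/

/-! ### Majorants and Frobenius' method -/

open Finset in
/-- A sequence satisfying the recursive estimate of the coefficients of a Fuchsian equation grows at
most geometrically, with any ratio larger than that of the coefficients of the equation. -/
theorem exists_geometric_bound {p : ℕ → ℝ} {K M ρ ρ' : ℝ} (hp : ∀ n, 0 ≤ p n)
    (hK : 0 ≤ K) (hM : 0 ≤ M) (hρ : 0 ≤ ρ) (hρ' : ρ < ρ')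
    (h : ∀ n : ℕ, ((n : ℝ) + 1) * p (n + 1) ≤ K * ∑ k ∈ range (n + 1), M * ρ ^ k * p (n - k)) :
    ∃ B, 0 ≤ B ∧ ∀ n, p n ≤ B * ρ' ^ n := by
  have hpos : 0 < ρ' := hρ.trans_lt hρ'
  have hd : 0 < ρ' - ρ := sub_pos.2 hρ'
  -- Beyond n₀ the factor n on the left of the recursion beats the constant K M / (ρ' - ρ) that
  -- comes from summing the geometric series. B only has to dominate the terms up to n₀.
  obtain ⟨n₀, hn₀⟩ := exists_nat_ge (K * M / (ρ' - ρ))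
  set B := ∑ m ∈ range (n₀ + 1), p m / ρ' ^ m with hB
  have hB0 : 0 ≤ B := sum_nonneg fun m _ => div_nonneg (hp m) (by positivity)
  refine ⟨B, hB0, fun n => ?_⟩
  induction n using Nat.strong_induction_on with
  | _ n ih =>
    by_cases hn : n < n₀ + 1
    · have h1 : p n / ρ' ^ n ≤ B :=
        single_le_sum (f := fun m => p m / ρ' ^ m)
          (fun m _ => div_nonneg (hp m) (by positivity)) (mem_range.2 hn)
      rwa [div_le_iff₀ (by positivity)] at h1
    · obtain ⟨m, rfl⟩ : ∃ m, n = m + 1 := ⟨n - 1, by omega⟩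
      have hgeom : ∑ k ∈ range (m + 1), ρ ^ k * ρ' ^ (m - k) ≤ ρ' ^ (m + 1) / (ρ' - ρ) := by
        have h2 := geom_sum₂_mul ρ ρ' (m + 1)
        simp only [Nat.add_sub_cancel] at h2
        rw [le_div_iff₀ hd]
        have : 0 ≤ ρ ^ (m + 1) := by positivity
        nlinarith
      have h3 : ∑ k ∈ range (m + 1), M * ρ ^ k * p (m - k) ≤
          M * B * (ρ' ^ (m + 1) / (ρ' - ρ)) := by
        refine le_trans ?_ (mul_le_mul_of_nonneg_left hgeom (by positivity))
        rw [mul_sum]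
        refine sum_le_sum fun k _ => ?_
        calc M * ρ ^ k * p (m - k) ≤ M * ρ ^ k * (B * ρ' ^ (m - k)) :=
              mul_le_mul_of_nonneg_left (ih _ (by omega)) (by positivity)
          _ = M * B * (ρ ^ k * ρ' ^ (m - k)) := by ring
      have h4 : ((m : ℝ) + 1) * p (m + 1) ≤ (m + 1) * (B * ρ' ^ (m + 1)) := by
        calc ((m : ℝ) + 1) * p (m + 1) ≤ K * (M * B * (ρ' ^ (m + 1) / (ρ' - ρ))) :=
              (h m).trans (mul_le_mul_of_nonneg_left h3 hK)
          _ = K * M / (ρ' - ρ) * (B * ρ' ^ (m + 1)) := by ring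
          _ ≤ (m + 1) * (B * ρ' ^ (m + 1)) := by
              refine mul_le_mul_of_nonneg_right (hn₀.trans ?_) (by positivity)
              exact_mod_cast (by omega : n₀ ≤ m + 1)
      exact le_of_mul_le_mul_left h4 (by positivity)

/-- A nilpotent operator has no eigenvalue `-n` for `n ≥ 1`, and the inverses of `n + L` are
`O(1 / n)`. -/
theorem exists_resolvent_bound {E : Type*} [NormedAddCommGroup E] [NormedSpace ℂ E]
    {L : E →L[ℂ] E} (hL : IsNilpotent L) :
    ∃ (T : ℕ → E →L[ℂ] E) (K : ℝ), 0 ≤ K ∧ ∀ n : ℕ, n ≠ 0 →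
      (∀ x, (n : ℂ) • T n x + L (T n x) = x) ∧ ∀ x, n * ‖T n x‖ ≤ K * ‖x‖ := by
  obtain ⟨m, hm⟩ := hL
  -- The Neumann series of (n + L)⁻¹, which is finite since L is nilpotent. As n⁻¹ ≤ 1, its terms
  -- are bounded uniformly in n.
  refine ⟨fun n => (n : ℂ)⁻¹ • ∑ j ∈ Finset.range m, (-((n : ℂ)⁻¹) • L) ^ j,
    ∑ j ∈ Finset.range m, ‖L ^ j‖, by positivity, fun n hn => ?_⟩
  have hn' : (n : ℂ) ≠ 0 := Nat.cast_ne_zero.2 hn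
  set Y := -((n : ℂ)⁻¹) • L with hY
  have hYm : Y ^ m = 0 := by rw [hY, smul_pow, hm, smul_zero]
  have hg : (1 - Y) * ∑ j ∈ Finset.range m, Y ^ j = 1 := by
    rw [mul_neg_geom_sum, hYm, sub_zero]
  constructor
  · intro x
    have h1 := congrArg (fun S : E →L[ℂ] E => S x) hg
    simp only [mul_apply_eq_comp, one_apply_eq_self, sub_apply, sub_mul, one_mul] at h1
    rw [smul_apply, map_smul, smul_smul, mul_inv_cancel₀ hn', one_smul]
    have hYx : ∀ w, Y w = -((n : ℂ)⁻¹ • L w) := fun w => by simp [hY]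
    rwa [hYx, sub_neg_eq_add] at h1
  · intro x
    have hbound : ‖(∑ j ∈ Finset.range m, Y ^ j) x‖ ≤ (∑ j ∈ Finset.range m, ‖L ^ j‖) * ‖x‖ := by
      refine (ContinuousLinearMap.le_opNorm _ _).trans (mul_le_mul_of_nonneg_right ?_ (norm_nonneg _))
      refine (norm_sum_le _ _).trans (Finset.sum_le_sum fun j _ => ?_)
      rw [hY, smul_pow, norm_smul]
      refine mul_le_of_le_one_left (norm_nonneg _) ?_
      rw [norm_pow, norm_neg, norm_inv, Complex.norm_natCast]
      refine pow_le_one₀ (by positivity) (inv_le_one_of_one_le₀ ?_)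
      exact_mod_cast Nat.one_le_iff_ne_zero.2 hn
    have hnr : (n : ℝ) ≠ 0 := Nat.cast_ne_zero.2 hn
    rw [smul_apply, norm_smul, norm_inv, Complex.norm_natCast, ← mul_assoc,
      mul_inv_cancel₀ hnr, one_mul]
    exact hbound

section Frobenius

variable {𝒜 : Type*} [NormedRing 𝒜] [NormedAlgebra ℂ 𝒜]

/-- The coefficients of the power series solution of `z P' + L P + z H P = 0`, where `T n` is the
inverse of `n + L` and `h` are the Taylor coefficients of `H`. -/
noncomputable def frobeniusCoeff (T : ℕ → 𝒜 →L[ℂ] 𝒜) (h : ℕ → 𝒜) : ℕ → 𝒜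
  | 0 => 1
  | n + 1 => -T (n + 1) (∑ k : Fin (n + 1), h k * frobeniusCoeff T h (n - k))

theorem frobeniusCoeff_succ (T : ℕ → 𝒜 →L[ℂ] 𝒜) (h : ℕ → 𝒜) (n : ℕ) :
    frobeniusCoeff T h (n + 1) =
      -T (n + 1) (∑ k ∈ Finset.range (n + 1), h k * frobeniusCoeff T h (n - k)) := by
  rw [frobeniusCoeff, Finset.sum_range]

variable [CompleteSpace 𝒜]

/-- The estimate holds because the terms of a series that converges at z = s are bounded. -/
theorem exists_taylor_coeff {H : ℂ → 𝒜} {r : ℝ} (hH : DifferentiableOn ℂ H (Metric.ball 0 r)) :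
    ∃ h : ℕ → 𝒜, (∀ z ∈ Metric.ball (0 : ℂ) r, HasSum (fun n => z ^ n • h n) (H z)) ∧
      ∀ s, 0 < s → s < r → ∃ M, 0 ≤ M ∧ ∀ n, ‖h n‖ ≤ M * s⁻¹ ^ n := by
  refine ⟨fun n => ((Nat.factorial n : ℂ)⁻¹) • iteratedDeriv n H 0, fun z hz => ?_, fun s hs hsr => ?_⟩
  · have := Complex.hasSum_taylorSeries_on_ball hH hz
    convert! this using 2 with n
    simp [smul_smul, mul_comm]
  · obtain ⟨s', hs', hs'r⟩ := exists_between hsr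
    have hsum : Summable fun n => ((s : ℂ)) ^ n • (((Nat.factorial n : ℂ)⁻¹) • iteratedDeriv n H 0) := by
      have hz : (s : ℂ) ∈ Metric.ball (0 : ℂ) r := by simpa [abs_of_pos hs] using hsr
      have := (Complex.hasSum_taylorSeries_on_ball hH hz).summable
      convert! this using 2 with n
      simp [smul_smul, mul_comm]
    obtain ⟨M, hM⟩ := (hsum.tendsto_atTop_zero.norm).bddAbove_range
    refine ⟨M, (norm_nonneg _).trans (hM ⟨0, rfl⟩), fun n => ?_⟩
    have := hM ⟨n, rfl⟩
    simp only [norm_smul ((s : ℂ) ^ n), norm_pow, Complex.norm_real, Real.norm_eq_abs,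
      abs_of_pos hs] at this
    rw [inv_pow, ← div_eq_mul_inv, le_div_iff₀ (by positivity), mul_comm]
    exact this

/-- **Frobenius method**, non-resonant case: if `ad C` is nilpotent and `H` is holomorphic on a disc,
then the equation `z P' = P C - (C + z H(z)) P` has a holomorphic solution on the whole disc with
`P(0) = 1`. -/
theorem exists_frobenius_solution {C : 𝒜}
    (hC : IsNilpotent (ContinuousLinearMap.mul ℂ 𝒜 C - (ContinuousLinearMap.mul ℂ 𝒜).flip C))
    {H : ℂ → 𝒜} {r : ℝ} (hH : DifferentiableOn ℂ H (Metric.ball 0 r)) :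
    ∃ P P' : ℂ → 𝒜, P 0 = 1 ∧ ∀ z ∈ Metric.ball (0 : ℂ) r, HasDerivAt P (P' z) z ∧
      z • P' z = P z * C - C * P z - z • (H z * P z) := by
  obtain ⟨h, hsum, hbd⟩ := exists_taylor_coeff hH
  obtain ⟨T, K, hK, hT⟩ := exists_resolvent_bound hC
  set p := frobeniusCoeff T h with hp
  -- The coefficient of z^(n+1) in the equation: (n + 1 + ad C) p (n+1) = -∑ h k * p (n-k).
  have hrec : ∀ n : ℕ, ((n : ℂ) + 1) • p (n + 1) = p (n + 1) * C - C * p (n + 1) -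
      ∑ k ∈ Finset.range (n + 1), h k * p (n - k) := by
    intro n
    have h1 := (hT (n + 1) n.succ_ne_zero).1 (∑ k ∈ Finset.range (n + 1), h k * p (n - k))
    rw [hp, frobeniusCoeff_succ, ← hp]
    simp only [sub_apply, ContinuousLinearMap.mul_apply',
      ContinuousLinearMap.flip_apply] at h1
    push_cast at h1
    generalize T (n + 1) (∑ k ∈ Finset.range (n + 1), h k * p (n - k)) = X at h1 ⊢
    rw [← h1, smul_neg, neg_mul, mul_neg]
    abel
  -- Every s < r is allowed because the Taylor coefficients of H are controlled at an intermediate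
  -- radius s'. Hence the series converges on the whole disc.
  have hbound : ∀ s, 0 < s → s < r → ∃ B, 0 ≤ B ∧ ∀ n, ‖p n‖ ≤ B * s⁻¹ ^ n := by
    intro s hs hsr
    obtain ⟨s', hs', hs'r⟩ := exists_between hsr
    have hs'0 : 0 < s' := hs.trans hs'
    obtain ⟨M, hM, hMh⟩ := hbd s' hs'0 hs'r
    refine exists_geometric_bound (K := K) (M := M) (ρ := s'⁻¹) (fun n => norm_nonneg _) hK hM
      (by positivity) (inv_strictAnti₀ hs hs') fun (n : ℕ) => ?_
    have h1 := (hT (n + 1) n.succ_ne_zero).2 (∑ k ∈ Finset.range (n + 1), h k * p (n - k))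
    rw [hp, frobeniusCoeff_succ, ← hp, norm_neg]
    push_cast at h1
    refine h1.trans (mul_le_mul_of_nonneg_left ?_ hK)
    refine (norm_sum_le _ _).trans (Finset.sum_le_sum fun k _ => ?_)
    exact (norm_mul_le _ _).trans (mul_le_mul_of_nonneg_right (hMh k) (norm_nonneg _))
  have hsummable : ∀ z ∈ Metric.ball (0 : ℂ) r, Summable fun n => ‖z ^ n • p n‖ := by
    intro z hz
    obtain ⟨s, hs, hsr⟩ := exists_between (mem_ball_zero_iff.1 hz)
    have hs0 : 0 < s := (norm_nonneg z).trans_lt hs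
    obtain ⟨B, hB, hBp⟩ := hbound s hs0 hsr
    have hg : Summable fun n : ℕ => B * (‖z‖ * s⁻¹) ^ n :=
      (summable_geometric_of_lt_one (by positivity)
        (by rwa [← div_eq_mul_inv, div_lt_one hs0])).mul_left B
    refine hg.of_nonneg_of_le (fun n => norm_nonneg _) fun n => ?_
    rw [norm_smul, norm_pow, mul_pow]
    calc ‖z‖ ^ n * ‖p n‖ ≤ ‖z‖ ^ n * (B * s⁻¹ ^ n) :=
          mul_le_mul_of_nonneg_left (hBp n) (by positivity)
      _ = B * (‖z‖ ^ n * s⁻¹ ^ n) := by ring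
  have hsummableH : ∀ z ∈ Metric.ball (0 : ℂ) r, Summable fun n => ‖z ^ n • h n‖ := by
    intro z hz
    obtain ⟨s, hs, hsr⟩ := exists_between (mem_ball_zero_iff.1 hz)
    have hs0 : 0 < s := (norm_nonneg z).trans_lt hs
    obtain ⟨B, hB, hBp⟩ := hbd s hs0 hsr
    have hg : Summable fun n : ℕ => B * (‖z‖ * s⁻¹) ^ n :=
      (summable_geometric_of_lt_one (by positivity)
        (by rwa [← div_eq_mul_inv, div_lt_one hs0])).mul_left B
    refine hg.of_nonneg_of_le (fun n => norm_nonneg _) fun n => ?_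
    rw [norm_smul, norm_pow, mul_pow]
    calc ‖z‖ ^ n * ‖h n‖ ≤ ‖z‖ ^ n * (B * s⁻¹ ^ n) :=
          mul_le_mul_of_nonneg_left (hBp n) (by positivity)
      _ = B * (‖z‖ ^ n * s⁻¹ ^ n) := by ring
  refine ⟨fun z => ∑' n, z ^ n • p n, fun z => ∑' n : ℕ, ((n : ℂ) * z ^ (n - 1)) • p n, ?_,
    fun z hz => ?_⟩
  · beta_reduce
    rw [tsum_eq_single 0 fun n hn => by simp [hn]]
    simp [hp, frobeniusCoeff]
  · obtain ⟨s, hs, hsr⟩ := exists_between (mem_ball_zero_iff.1 hz)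
    obtain ⟨s', hs', hs'r⟩ := exists_between hsr
    have hs0 : 0 < s := (norm_nonneg z).trans_lt hs
    have hs'0 : 0 < s' := hs0.trans hs'
    obtain ⟨B, hB, hBp⟩ := hbound s' hs'0 hs'r
    -- A summable majorant of the differentiated series on the ball of radius s, where s < s' < r
    -- absorbs the factor n.
    have hu : Summable fun n : ℕ => (n : ℝ) * s ^ (n - 1) * (B * s'⁻¹ ^ n) := by
      have h1 : Summable fun n : ℕ => (n : ℝ) * (s * s'⁻¹) ^ n := by
        have := summable_pow_mul_geometric_of_norm_lt_one (R := ℝ) 1 (r := s * s'⁻¹) (by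
          rw [Real.norm_eq_abs, abs_of_pos (by positivity), ← div_eq_mul_inv, div_lt_one hs'0]
          exact hs')
        simpa using this
      refine (h1.mul_left (B * s⁻¹)).congr fun n => ?_
      rcases n with _ | n
      · simp
      · simp only [Nat.add_sub_cancel, mul_pow, pow_succ s]
        field_simp
    have hle : ∀ (n : ℕ) (y : ℂ), y ∈ Metric.ball (0 : ℂ) s →
        ‖((n : ℂ) * y ^ (n - 1)) • p n‖ ≤ (n : ℝ) * s ^ (n - 1) * (B * s'⁻¹ ^ n) := by
      intro n y hy
      rw [norm_smul, norm_mul, norm_pow, Complex.norm_natCast]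
      have hy' : ‖y‖ ≤ s := (mem_ball_zero_iff.1 hy).le
      gcongr
      exact hBp n
    have hzs : z ∈ Metric.ball (0 : ℂ) s := mem_ball_zero_iff.2 hs
    have hder : HasDerivAt (fun z : ℂ => ∑' n, z ^ n • p n)
        (∑' n : ℕ, ((n : ℂ) * z ^ (n - 1)) • p n) z :=
      hasDerivAt_tsum_of_isPreconnected (t := Metric.ball (0 : ℂ) s) hu Metric.isOpen_ball
        (convex_ball _ _).isPreconnected
        (fun n y _ => (hasDerivAt_pow n y).smul_const (p n)) hle hzs (hsummable z hz).of_norm hzs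
    refine ⟨hder, ?_⟩
    have hS' : Summable fun n : ℕ => ((n : ℂ) * z ^ (n - 1)) • p n :=
      Summable.of_norm_bounded hu fun n => hle n z hzs
    have hS := (hsummable z hz).of_norm
    have hcauchy := tsum_mul_tsum_eq_tsum_sum_range_of_summable_norm
      (hsummableH z hz) (hsummable z hz)
    have hcs := summable_norm_sum_mul_range_of_summable_norm (hsummableH z hz) (hsummable z hz)
    rw [(hsum z hz).tsum_eq] at hcauchy
    have hzero : (0 : 𝒜) = ((0 : ℕ) : ℂ) • (z ^ 0 • p 0) := by simp
    -- Both sides become power series. The constant terms vanish, since p 0 = 1 commutes with C; the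
    -- others match by the recursion.
    rw [hcauchy, ← hS.tsum_mul_right, ← hS.tsum_mul_left, ← (hS.mul_right C).tsum_sub (hS.mul_left C),
      ← tsum_const_smul'' z, ← tsum_const_smul'' z,
      ((hS.mul_right C).sub (hS.mul_left C)).tsum_eq_zero_add,
      (hS'.const_smul z).tsum_eq_zero_add]
    have h0 : p 0 = 1 := by simp [hp, frobeniusCoeff]
    simp only [Nat.cast_zero, zero_mul, zero_smul, smul_zero, zero_add, pow_zero, one_smul, h0,
      one_mul, mul_one, sub_self]
    rw [← ((summable_nat_add_iff 1).2 ((hS.mul_right C).sub (hS.mul_left C))).tsum_sub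
      (hcs.of_norm.const_smul z)]
    refine tsum_congr fun n => ?_
    have h5 : z • ∑ k ∈ Finset.range (n + 1), z ^ k • h k * z ^ (n - k) • p (n - k) =
        z ^ (n + 1) • ∑ k ∈ Finset.range (n + 1), h k * p (n - k) := by
      rw [Finset.smul_sum, Finset.smul_sum]
      refine Finset.sum_congr rfl fun k hk => ?_
      have hk' : k ≤ n := Nat.lt_succ_iff.1 (Finset.mem_range.1 hk)
      rw [smul_mul_smul_comm, ← pow_add, Nat.add_sub_cancel' hk', smul_smul, ← pow_succ']
    rw [h5, smul_mul_assoc, mul_smul_comm, ← smul_sub, ← smul_sub, ← hrec n, smul_smul, smul_smul]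
    congr 1
    push_cast
    ring

end Frobenius

/-! ### Finite-dimensional modules and sl₂-triples -/

section SlTwo

variable {V : Type*} [AddCommGroup V] [Module ℂ V]

/-- An operator which raises the eigenvalues of another operator by `c ≠ 0` is nilpotent. -/
theorem isNilpotent_of_mul_sub_mul_eq_smul [FiniteDimensional ℂ V] {T X : Module.End ℂ V} {c : ℂ}
    (hc : c ≠ 0) (h : T * X - X * T = c • X) : IsNilpotent X := by
  by_contra hX
  have hX' : ∀ k, X ^ k ≠ 0 := fun k hk => hX ⟨k, hk⟩
  have hpow : ∀ k : ℕ, T * X ^ k - X ^ k * T = (k * c) • X ^ k := by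
    intro k
    induction k with
    | zero => simp
    | succ k ih =>
      have : T * X ^ (k + 1) - X ^ (k + 1) * T =
          (T * X ^ k - X ^ k * T) * X + X ^ k * (T * X - X * T) := by
        rw [pow_succ]; noncomm_ring
      rw [this, ih, h, smul_mul_assoc, mul_smul_comm, ← pow_succ, ← add_smul]
      push_cast
      ring_nf
  -- If no power of X vanished, the powers would be eigenvectors of [T, ·] with the distinct
  -- eigenvalues k c, hence infinitely many independent operators.
  have hli := Module.End.eigenvectors_linearIndependent'
    (LinearMap.mulLeft ℂ T - LinearMap.mulRight ℂ T) (fun k : ℕ => (k : ℂ) * c)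
    (fun a b hab => by simpa [hc] using hab) (fun k => X ^ k)
    fun k => ⟨by
      rw [Module.End.mem_eigenspace_iff]
      simpa using hpow k, hX' k⟩
  exact not_finite_iff_infinite.2 inferInstance hli.finite

theorem semiconjBy_pow_mem_maxGenEigenspace {T X : Module.End ℂ V} {c : ℂ}
    (h : T * X - X * T = c • X) {μ : ℂ} {v : V} (hv : v ∈ T.maxGenEigenspace μ) :
    X v ∈ T.maxGenEigenspace (μ + c) := by
  rw [Module.End.mem_maxGenEigenspace] at hv ⊢
  obtain ⟨k, hk⟩ := hv
  have hs : SemiconjBy X (T - μ • 1) (T - (μ + c) • 1) := by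
    rw [SemiconjBy, mul_sub, sub_mul, mul_smul_comm, smul_mul_assoc, mul_one, one_mul, add_smul, ← h]
    abel
  refine ⟨k, ?_⟩
  have := congrArg (fun S : Module.End ℂ V => S v) (hs.pow_right k).eq
  simp only [Module.End.mul_apply] at this
  rw [← this, hk, map_zero]

variable {L : Type*} [LieRing L] [LieAlgebra ℂ L] [LieRingModule L V] [LieModule ℂ L V]

open LieModule in
/-- The Casimir operator of an `sl₂`-triple, up to normalization. -/
noncomputable def slTwoCasimir (V : Type*) [AddCommGroup V] [Module ℂ V] [LieRingModule L V]
    [LieModule ℂ L V] (h e f : L) : Module.End ℂ V :=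
  (4 : ℂ) • (toEnd ℂ L V f * toEnd ℂ L V e) + (2 : ℂ) • toEnd ℂ L V h +
    toEnd ℂ L V h * toEnd ℂ L V h

variable {h e f : L} (t : IsSl2Triple h e f)

include t

open LieModule

theorem slTwo_lie_h_e : toEnd ℂ L V h * toEnd ℂ L V e - toEnd ℂ L V e * toEnd ℂ L V h =
    (2 : ℂ) • toEnd ℂ L V e := by
  ext v
  simp only [LinearMap.sub_apply, Module.End.mul_apply, toEnd_apply_apply, LinearMap.smul_apply]
  rw [← lie_lie, t.lie_h_e_smul ℂ, smul_lie]

theorem slTwo_lie_h_f : toEnd ℂ L V h * toEnd ℂ L V f - toEnd ℂ L V f * toEnd ℂ L V h =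
    (-2 : ℂ) • toEnd ℂ L V f := by
  ext v
  simp only [LinearMap.sub_apply, Module.End.mul_apply, toEnd_apply_apply, LinearMap.smul_apply]
  rw [← lie_lie, t.lie_lie_smul_f ℂ, neg_lie, smul_lie, neg_smul]

theorem slTwo_lie_e_f : toEnd ℂ L V e * toEnd ℂ L V f - toEnd ℂ L V f * toEnd ℂ L V e =
    toEnd ℂ L V h := by
  ext v
  simp only [LinearMap.sub_apply, Module.End.mul_apply, toEnd_apply_apply]
  rw [← lie_lie, t.lie_e_f]

/-- On a vector killed by e and by f^(n+1), this relation gives f^n (h - n) v = 0. That drives the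
induction in `slTwo_lie_h_of_e_eq_zero`. -/
theorem slTwo_e_mul_f_pow_succ (n : ℕ) :
    toEnd ℂ L V e * toEnd ℂ L V f ^ (n + 1) = toEnd ℂ L V f ^ (n + 1) * toEnd ℂ L V e +
      ((n : ℂ) + 1) • (toEnd ℂ L V f ^ n * (toEnd ℂ L V h - (n : ℂ) • 1)) := by
  have h1 := slTwo_lie_e_f (V := V) t
  have h2 := slTwo_lie_h_f (V := V) t
  set E := toEnd ℂ L V e
  set F := toEnd ℂ L V f
  set T := toEnd ℂ L V h
  have hEF : E * F = F * E + T := by rw [← h1]; abel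
  have hTF : T * F = F * T - (2 : ℂ) • F := by rw [eq_sub_iff_add_eq, ← sub_eq_zero]; rw [neg_smul, ← sub_eq_zero] at h2; rw [← h2]; abel
  induction n with
  | zero => simp [hEF]
  | succ n ih =>
    rw [pow_succ F (n + 1), ← mul_assoc, ih, add_mul, mul_assoc, hEF, smul_mul_assoc, mul_assoc (F ^ n),
      sub_mul, hTF, smul_mul_assoc, one_mul, mul_add, ← mul_assoc]
    have h3 : F ^ n * (F * T - (2 : ℂ) • F - (n : ℂ) • F) =
        F ^ (n + 1) * T - ((n : ℂ) + 2) • F ^ (n + 1) := by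
      rw [mul_sub, mul_sub, ← mul_assoc, ← pow_succ, mul_smul_comm, mul_smul_comm, ← pow_succ]
      module
    rw [h3, mul_sub, mul_smul_comm, mul_one]
    push_cast
    module

theorem slTwoCasimir_commute_h : Commute (slTwoCasimir V h e f) (toEnd ℂ L V h) := by
  have h2 := slTwo_lie_h_f (V := V) t
  have h3 := slTwo_lie_h_e (V := V) t
  unfold slTwoCasimir
  set E := toEnd ℂ L V e
  set F := toEnd ℂ L V f
  set T := toEnd ℂ L V h
  have h4 : F * E * T = T * (F * E) := by
    have : T * (F * E) - F * E * T = (T * F - F * T) * E + F * (T * E - E * T) := by noncomm_ring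
    rw [h2, h3, smul_mul_assoc, mul_smul_comm, ← add_smul, neg_add_cancel, zero_smul,
      sub_eq_zero] at this
    exact this.symm
  have h5 : Commute (F * E) T := h4
  exact ((h5.smul_left _).add_left ((Commute.refl T).smul_left _)).add_left
    ((Commute.refl T).mul_left (Commute.refl T))

theorem slTwoCasimir_commute_e : Commute (slTwoCasimir V h e f) (toEnd ℂ L V e) := by
  have h1 := slTwo_lie_e_f (V := V) t
  have h3 := slTwo_lie_h_e (V := V) t
  unfold slTwoCasimir
  set E := toEnd ℂ L V e
  set F := toEnd ℂ L V f
  set T := toEnd ℂ L V h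
  have hFE : F * E = E * F - T := by rw [← h1]; abel
  have hTE : T * E = E * T + (2 : ℂ) • E := by rw [← h3]; abel
  change _ * E = E * _
  rw [hFE]
  simp only [add_mul, mul_add, smul_mul_assoc, mul_smul_comm, sub_mul, mul_sub, mul_assoc, hFE, hTE,
    smul_sub, smul_add]
  simp only [← mul_assoc, hTE, add_mul, smul_mul_assoc]
  module

omit t in
theorem slTwoCasimir_apply_of_e_eq_zero {v : V} {ν : ℂ} (he : ⁅e, v⁆ = 0) (hh : ⁅h, v⁆ = ν • v) :
    slTwoCasimir V h e f v = (ν * (ν + 2)) • v := by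
  simp only [slTwoCasimir, LinearMap.add_apply, LinearMap.smul_apply, Module.End.mul_apply,
    toEnd_apply_apply, he, hh, lie_zero, lie_smul]
  module

variable [FiniteDimensional ℂ V]

/-- On generalized weight vectors killed by `e`, the operator `h` is diagonalizable. -/
theorem slTwo_lie_h_of_e_eq_zero {μ : ℂ} {v : V} (he : ⁅e, v⁆ = 0)
    (hv : v ∈ (toEnd ℂ L V h).maxGenEigenspace μ) : ⁅h, v⁆ = μ • v := by
  obtain ⟨n, hn⟩ := isNilpotent_of_mul_sub_mul_eq_smul (by norm_num) (slTwo_lie_h_f (V := V) t)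
  replace hn : (toEnd ℂ L V f ^ n) v = 0 := by rw [hn]; rfl
  induction n generalizing v with
  | zero => have : v = 0 := by simpa using hn
            simp [this]
  | succ n ih =>
    -- w is killed by e and already by f^n, so induction gives h w = μ w.
    set w := ⁅h, v⁆ - (n : ℂ) • v with hw
    have hwe : ⁅e, w⁆ = 0 := by
      have h1 : ⁅h, ⁅e, v⁆⁆ = ⁅⁅h, e⁆, v⁆ + ⁅e, ⁅h, v⁆⁆ := leibniz_lie _ _ _
      rw [t.lie_h_e_smul ℂ, smul_lie, he, lie_zero, smul_zero, zero_add] at h1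
      rw [hw, lie_sub, lie_smul, he, ← h1, smul_zero, sub_zero]
    have hhv : ⁅h, v⁆ ∈ (toEnd ℂ L V h).maxGenEigenspace μ :=
      Module.End.mapsTo_maxGenEigenspace_of_comm (Commute.refl _) μ hv
    have hwg : w ∈ (toEnd ℂ L V h).maxGenEigenspace μ :=
      sub_mem hhv (Submodule.smul_mem _ _ hv)
    have hwn : (toEnd ℂ L V f ^ n) w = 0 := by
      have h1 := congrArg (fun S : Module.End ℂ V => S v) (slTwo_e_mul_f_pow_succ (V := V) t n)
      simp only [Module.End.mul_apply, hn, map_zero, LinearMap.add_apply, toEnd_apply_apply, he,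
        zero_add, LinearMap.smul_apply, LinearMap.sub_apply, Module.End.one_apply] at h1
      exact (smul_eq_zero.1 h1.symm).resolve_left (Nat.cast_add_one_ne_zero n)
    have hwμ := ih hwe hwg hwn
    by_cases hμ : μ = n
    · by_cases hw0 : w = 0
      · rw [hμ]; exact sub_eq_zero.1 hw0
      · have P : t.HasPrimitiveVectorWith w μ := ⟨hw0, hwμ, hwe⟩
        -- A primitive vector of weight n cannot be killed by f^n.
        exact absurd hwn (P.pow_toEnd_f_ne_zero_of_eq_nat hμ le_rfl)
    -- Now (h - n)(h - μ) v = 0, so u is an eigenvector for n inside the generalized eigenspace of μ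
    -- ≠ n.
    · set u := ⁅h, v⁆ - μ • v with hu
      have hug : u ∈ (toEnd ℂ L V h).maxGenEigenspace μ := sub_mem hhv (Submodule.smul_mem _ _ hv)
      have hun : u ∈ (toEnd ℂ L V h).eigenspace (n : ℂ) := by
        rw [Module.End.mem_eigenspace_iff, toEnd_apply_apply]
        rw [hw, lie_sub, lie_smul, ← sub_eq_zero] at hwμ
        rw [hu, lie_sub, lie_smul, ← sub_eq_zero, ← hwμ]
        module
      have := ((toEnd ℂ L V h).disjoint_genEigenspace hμ ⊤ 1).le_bot ⟨hug, hun⟩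
      exact sub_eq_zero.1 ((Submodule.mem_bot ℂ).1 this)

/-- In a block of the Casimir operator, the height of a generalized weight vector is determined by
its weight. -/
theorem slTwo_exists_top {μ c : ℂ} {v : V} (hv0 : v ≠ 0)
    (hv : v ∈ (toEnd ℂ L V h).maxGenEigenspace μ)
    (hc : v ∈ (slTwoCasimir V h e f).maxGenEigenspace c) :
    ∃ k ν : ℕ, (toEnd ℂ L V e ^ k) v ≠ 0 ∧
      ⁅h, (toEnd ℂ L V e ^ k) v⁆ = (μ + 2 * k) • (toEnd ℂ L V e ^ k) v ∧
      μ + 2 * k = ν ∧ c = ν * (ν + 2) := by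
  obtain ⟨n, hn⟩ := isNilpotent_of_mul_sub_mul_eq_smul (by norm_num) (slTwo_lie_h_e (V := V) t)
  obtain ⟨k, hk, hk'⟩ := Nat.exists_not_and_succ_of_not_zero_of_exists
    (p := fun k => (toEnd ℂ L V e ^ k) v = 0) hv0 ⟨n, by rw [hn]; rfl⟩
  have hmem : ∀ j : ℕ, (toEnd ℂ L V e ^ j) v ∈ (toEnd ℂ L V h).maxGenEigenspace (μ + 2 * j) := by
    intro j
    induction j with
    | zero => simpa using hv
    | succ j ih =>
      rw [pow_succ', Module.End.mul_apply]
      have := semiconjBy_pow_mem_maxGenEigenspace (slTwo_lie_h_e (V := V) t) ih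
      convert this using 2
      push_cast
      ring
  have he : ⁅e, (toEnd ℂ L V e ^ k) v⁆ = 0 := by
    rw [← hk', pow_succ', Module.End.mul_apply]; rfl
  have hh := slTwo_lie_h_of_e_eq_zero t he (hmem k)
  have P : t.HasPrimitiveVectorWith ((toEnd ℂ L V e ^ k) v) (μ + 2 * (k : ℂ)) := ⟨hk, hh, he⟩
  obtain ⟨ν, hν⟩ := P.exists_nat
  refine ⟨k, ν, hk, hh, hν, ?_⟩
  have h1 := slTwoCasimir_apply_of_e_eq_zero (f := f) he hh
  rw [hν] at h1
  have h2 : (toEnd ℂ L V e ^ k) v ∈ (slTwoCasimir V h e f).maxGenEigenspace c :=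
    Module.End.mapsTo_maxGenEigenspace_of_comm ((slTwoCasimir_commute_e t).pow_right k) c hc
  by_contra hne
  have := ((slTwoCasimir V h e f).disjoint_genEigenspace hne ⊤ 1).le_bot
    ⟨h2, (Module.End.mem_eigenspace_iff.2 h1)⟩
  exact hk ((Submodule.mem_bot ℂ).1 this)

/-- If u = (h - μ) v were nonzero, it would lie in the same block as v and so need the same number k
of applications of e to reach its top, since c determines the top weight ν ≥ 0 and then k = (ν - μ)
/ 2. But e^k u = (h - μ - 2k) e^k v = 0. -/
theorem slTwo_lie_h_of_mem {μ c : ℂ} {v : V}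
    (hv : v ∈ (toEnd ℂ L V h).maxGenEigenspace μ)
    (hc : v ∈ (slTwoCasimir V h e f).maxGenEigenspace c) : ⁅h, v⁆ = μ • v := by
  by_contra hne
  set u := ⁅h, v⁆ - μ • v with hu
  have hu0 : u ≠ 0 := sub_ne_zero.2 hne
  have hv0 : v ≠ 0 := by rintro rfl; simp at hne
  have hug : u ∈ (toEnd ℂ L V h).maxGenEigenspace μ :=
    sub_mem (Module.End.mapsTo_maxGenEigenspace_of_comm (Commute.refl _) μ hv)
      (Submodule.smul_mem _ _ hv)
  have huc : u ∈ (slTwoCasimir V h e f).maxGenEigenspace c :=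
    sub_mem (Module.End.mapsTo_maxGenEigenspace_of_comm (slTwoCasimir_commute_h t) c hc)
      (Submodule.smul_mem _ _ hc)
  obtain ⟨k, ν, hk, hh, hν, hcν⟩ := slTwo_exists_top t hv0 hv hc
  obtain ⟨k', ν', hk', -, hν', hcν'⟩ := slTwo_exists_top t hu0 hug huc
  have hνν : ν = ν' := by
    have h1 : ν * (ν + 2) = ν' * (ν' + 2) := by exact_mod_cast hcν.symm.trans hcν'
    nlinarith [lt_trichotomy ν ν']
  have hkk : k' = k := by
    have : (2 : ℂ) * k' = 2 * k := by
      rw [hνν, ← hν'] at hν; linear_combination -hν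
    simpa using this
  apply hk'
  have hpow : ∀ j : ℕ, (toEnd ℂ L V e ^ j) ⁅h, v⁆ =
      ⁅h, (toEnd ℂ L V e ^ j) v⁆ - (2 * j : ℂ) • (toEnd ℂ L V e ^ j) v := by
    intro j
    induction j with
    | zero => simp
    | succ j ih =>
      rw [pow_succ', Module.End.mul_apply, ih, Module.End.mul_apply, map_sub, map_smul,
        toEnd_apply_apply, toEnd_apply_apply, leibniz_lie h e, t.lie_h_e_smul ℂ, smul_lie]
      push_cast
      module
  rw [hkk, hu, map_sub, map_smul, hpow, hh]
  module

/-- In every finite-dimensional module, the semisimple element of an `sl₂`-triple acts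
diagonalizably, with integral eigenvalues. -/
theorem slTwo_iSup_eigenspace_intCast :
    ⨆ m : ℤ, (toEnd ℂ L V h).eigenspace (m : ℂ) = ⊤ := by
  -- The space splits into simultaneous generalized eigenspaces of the commuting operators h and
  -- Casimir.
  rw [eq_top_iff, ← Module.End.iSup_iInf_maxGenEigenspace_eq_top_of_iSup_maxGenEigenspace_eq_top_of_commute
    (fun i : Bool => if i then toEnd ℂ L V h else slTwoCasimir V h e f) ?_
    (fun i => Module.End.iSup_maxGenEigenspace_eq_top _)]
  · refine iSup_le fun χ v hv => ?_
    simp only [Submodule.mem_iInf, Bool.forall_bool] at hv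
    obtain ⟨hc, hv⟩ := hv
    by_cases hv0 : v = 0
    · rw [hv0]; exact zero_mem _
    · have hh := slTwo_lie_h_of_mem t hv hc
      obtain ⟨k, ν, -, -, hν, -⟩ := slTwo_exists_top t hv0 hv hc
      refine Submodule.mem_iSup_of_mem ((ν : ℤ) - 2 * k) ?_
      rw [Module.End.mem_eigenspace_iff, toEnd_apply_apply, hh]
      congr 1
      push_cast
      linear_combination hν
  · rintro (_ | _) (_ | _) hij
    · exact absurd rfl hij
    · exact slTwoCasimir_commute_h t
    · exact (slTwoCasimir_commute_h t).symm
    · exact absurd rfl hij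

end SlTwo

/-! ### Eigenspace gradings of a Lie algebra and `ad`-nilpotency -/

section Grading

open LieAlgebra

variable {𝔤 : Type*} [LieRing 𝔤] [LieAlgebra ℂ 𝔤]

theorem mem_adEigenspace {S x : 𝔤} {c : ℂ} : x ∈ adEigenspace S c ↔ ⁅S, x⁆ = c • x := Iff.rfl

theorem adEigenspace_eq (S : 𝔤) (c : ℂ) : adEigenspace S c = (ad ℂ 𝔤 S).eigenspace c := by
  ext x
  rw [mem_adEigenspace, Module.End.mem_eigenspace_iff, ad_apply]

theorem lie_mem_adEigenspace {S x y : 𝔤} {c d : ℂ} (hx : x ∈ adEigenspace S c)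
    (hy : y ∈ adEigenspace S d) : ⁅x, y⁆ ∈ adEigenspace S (c + d) := by
  rw [mem_adEigenspace] at *
  rw [leibniz_lie, hx, hy, smul_lie, lie_smul, add_smul]

theorem iSupIndep_adEigenspace (S : 𝔤) : iSupIndep (adEigenspace S) := by
  simpa only [funext (adEigenspace_eq S)] using (ad ℂ 𝔤 S).eigenspaces_iSupIndep

/-- This guarantees that `adEigenProj` is the true projection and not its default value 0. -/
theorem isCompl_adEigenspace {S : 𝔤} (hS : ⨆ c, adEigenspace S c = ⊤) (c : ℂ) :
    IsCompl (adEigenspace S c) (⨆ d : {d : ℂ // d ≠ c}, adEigenspace S (d : ℂ)) := by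
  refine ⟨?_, ?_⟩
  · rw [iSup_subtype]
    exact iSupIndep_adEigenspace S c
  · rw [codisjoint_iff, eq_top_iff, ← hS]
    refine iSup_le fun d => ?_
    by_cases hd : d = c
    · rw [hd]; exact le_sup_left
    · exact (le_iSup (fun d : {d : ℂ // d ≠ c} => adEigenspace S (d : ℂ)) ⟨d, hd⟩).trans le_sup_right

theorem adEigenProj_mem (S : 𝔤) (c : ℂ) (x : 𝔤) : adEigenProj S c x ∈ adEigenspace S c := by
  unfold adEigenProj
  split_ifs with h
  · exact Submodule.projection_apply_mem h x
  · exact zero_mem _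

theorem adEigenProj_of_mem {S : 𝔤} (hS : ⨆ c, adEigenspace S c = ⊤) {c : ℂ} {x : 𝔤}
    (hx : x ∈ adEigenspace S c) : adEigenProj S c x = x := by
  rw [adEigenProj, dif_pos (isCompl_adEigenspace hS c)]
  exact Submodule.projection_apply_of_mem_left _ hx

theorem adEigenProj_of_mem_ne {S : 𝔤} (hS : ⨆ c, adEigenspace S c = ⊤) {c d : ℂ} (hd : d ≠ c)
    {x : 𝔤} (hx : x ∈ adEigenspace S d) : adEigenProj S c x = 0 := by
  rw [adEigenProj, dif_pos (isCompl_adEigenspace hS c)]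
  exact Submodule.projection_apply_of_mem_right _
    (Submodule.mem_iSup_of_mem (p := fun d : {d : ℂ // d ≠ c} => adEigenspace S (d : ℂ)) ⟨d, hd⟩ hx)

theorem sum_adEigenProj {S : 𝔤} {s : Finset ℂ} (hS : ⨆ c ∈ s, adEigenspace S c = ⊤) (x : 𝔤) :
    ∑ c ∈ s, adEigenProj S c x = x := by
  have hS' : ⨆ c, adEigenspace S c = ⊤ := by
    rw [eq_top_iff, ← hS]
    exact iSup₂_le_iSup _ _
  have hle : ⨆ c ∈ s, adEigenspace S c ≤
      LinearMap.eqLocus (∑ c ∈ s, adEigenProj S c) LinearMap.id := by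
    refine iSup₂_le fun d hd y hy => ?_
    rw [LinearMap.mem_eqLocus, LinearMap.sum_apply, LinearMap.id_apply,
      Finset.sum_eq_single_of_mem d hd fun c _ hc => adEigenProj_of_mem_ne hS' hc.symm hy,
      adEigenProj_of_mem hS' hy]
  have := hle (hS ▸ Submodule.mem_top (x := x))
  simpa [LinearMap.mem_eqLocus] using this

theorem eq_zero_of_mem_adEigenspace {S : 𝔤} {s : Finset ℂ} (hS : ⨆ c ∈ s, adEigenspace S c = ⊤)
    {c : ℂ} (hc : c ∉ s) {x : 𝔤} (hx : x ∈ adEigenspace S c) : x = 0 := by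
  have hS' : ⨆ c, adEigenspace S c = ⊤ := by
    rw [eq_top_iff, ← hS]
    exact iSup₂_le_iSup _ _
  rw [← sum_adEigenProj hS x]
  exact Finset.sum_eq_zero fun d hd =>
    adEigenProj_of_mem_ne hS' (fun h : c = d => hc (h.symm ▸ hd)) hx

/-- If subspaces consisting of eigenvectors of `ad S` span `𝔤`, then those among them with
eigenvalue `c` span the `c`-eigenspace. -/
theorem adEigenspace_le_iSup {S : 𝔤} {κ : Type*} {E : κ → Submodule ℂ 𝔤} {w : κ → ℂ}
    (hE : ∀ k, E k ≤ adEigenspace S (w k)) (htop : ⨆ k, E k = ⊤) (c : ℂ) :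
    adEigenspace S c ≤ ⨆ k, ⨆ (_ : w k = c), E k := by
  have hS : ⨆ c, adEigenspace S c = ⊤ := by
    rw [eq_top_iff, ← htop]
    exact iSup_le fun k => (hE k).trans (le_iSup _ _)
  intro x hx
  have hle : ⨆ k, E k ≤ (⨆ k, ⨆ (_ : w k = c), E k).comap (adEigenProj S c) := by
    refine iSup_le fun k y hy => ?_
    rw [Submodule.mem_comap]
    by_cases hk : w k = c
    · rw [adEigenProj_of_mem hS (hk ▸ hE k hy)]
      exact Submodule.mem_iSup_of_mem k (Submodule.mem_iSup_of_mem hk hy)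
    · rw [adEigenProj_of_mem_ne hS hk (hE k hy)]
      exact zero_mem _
  have := hle (htop ▸ Submodule.mem_top (x := x))
  rwa [Submodule.mem_comap, adEigenProj_of_mem hS hx] at this

theorem map_mem_adEigenspace_iff (σ : 𝔤 ≃ₗ⁅ℂ⁆ 𝔤) {S x : 𝔤} {c : ℂ} :
    σ x ∈ adEigenspace (σ S) c ↔ x ∈ adEigenspace S c := by
  rw [mem_adEigenspace, mem_adEigenspace, ← LieEquiv.map_lie, ← map_smul,
    EmbeddingLike.apply_eq_iff_eq]

theorem iSup_adEigenspace_map (σ : 𝔤 ≃ₗ⁅ℂ⁆ 𝔤) {S : 𝔤} {s : Finset ℂ}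
    (hS : ⨆ c ∈ s, adEigenspace S c = ⊤) : ⨆ c ∈ s, adEigenspace (σ S) c = ⊤ := by
  rw [eq_top_iff]
  intro x _
  have hle : ⨆ c ∈ s, adEigenspace S c ≤
      (⨆ c ∈ s, adEigenspace (σ S) c).comap (σ : 𝔤 →ₗ[ℂ] 𝔤) :=
    iSup₂_le fun c hc y hy => Submodule.mem_iSup_of_mem c
      (Submodule.mem_iSup_of_mem hc ((map_mem_adEigenspace_iff σ).2 hy))
  have := hle (hS ▸ Submodule.mem_top (x := σ.symm x))
  rw [Submodule.mem_comap] at this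
  simpa using this

theorem mem_adEigenspace_neg {S x : 𝔤} {c : ℂ} : x ∈ adEigenspace (-S) (-c) ↔ x ∈ adEigenspace S c := by
  rw [mem_adEigenspace, mem_adEigenspace, neg_lie, neg_smul, neg_inj]

/-- An operator which agrees with a nilpotent operator on the graded pieces of a finite filtration
is nilpotent. -/
theorem isNilpotent_of_filtration {V : Type*} [AddCommGroup V] [Module ℂ V] {T T₀ : Module.End ℂ V}
    (h₀ : IsNilpotent T₀) (F : ℕ → Submodule ℂ V) (hF : F 0 = ⊤) {m : ℕ} (hm : F m = ⊥)
    (hT₀ : ∀ k, ∀ x ∈ F k, T₀ x ∈ F k) (hF' : ∀ k, F (k + 1) ≤ F k)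
    (hT : ∀ k, ∀ x ∈ F k, T x - T₀ x ∈ F (k + 1)) : IsNilpotent T := by
  obtain ⟨n, hn⟩ := h₀
  have hTk : ∀ k, ∀ x ∈ F k, T x ∈ F k := fun k x hx => by
    have := add_mem (hF' k (hT k x hx)) (hT₀ k x hx)
    rwa [sub_add_cancel] at this
  -- T and T₀ have the same powers on the graded pieces, so T^n raises the filtration when T₀^n = 0.
  have hpow : ∀ k, ∀ x ∈ F k, ∀ j : ℕ, (T₀ ^ j) x ∈ F k ∧ (T ^ j) x - (T₀ ^ j) x ∈ F (k + 1) := by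
    intro k x hx j
    induction j with
    | zero => simpa using hx
    | succ j ih =>
      simp only [pow_succ', Module.End.mul_apply]
      refine ⟨hT₀ k _ ih.1, ?_⟩
      have : T ((T ^ j) x) - T₀ ((T₀ ^ j) x) =
          T ((T ^ j) x - (T₀ ^ j) x) + (T ((T₀ ^ j) x) - T₀ ((T₀ ^ j) x)) := by
        rw [map_sub]; abel
      rw [this]
      exact add_mem (hTk _ _ ih.2) (hT k _ ih.1)
  have hstep : ∀ k, ∀ x ∈ F k, (T ^ n) x ∈ F (k + 1) := fun k x hx => by
    have := (hpow k x hx n).2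
    rwa [hn, LinearMap.zero_apply, sub_zero] at this
  have hall : ∀ (k : ℕ) (x : V), ((T ^ n) ^ k) x ∈ F k := by
    intro k x
    induction k with
    | zero => rw [hF]; exact Submodule.mem_top
    | succ k ih => rw [pow_succ', Module.End.mul_apply]; exact hstep k _ ih
  refine ⟨n * m, ?_⟩
  ext x
  have := hall m x
  rw [hm, Submodule.mem_bot, ← pow_mul] at this
  exact this

/-- If `S` is `ad`-diagonalizable, `N` commutes with `S` and is `ad`-nilpotent, and `X` is a sum of
eigenvectors of `ad S` with positive eigenvalues, then `N + X` is `ad`-nilpotent. -/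
theorem isNilpotent_ad_add [FiniteDimensional ℂ 𝔤] {S N X : 𝔤} (hS : ⨆ c, adEigenspace S c = ⊤)
    (hSN : ⁅S, N⁆ = 0) (hN : IsNilpotent (ad ℂ 𝔤 N))
    (hX : X ∈ ⨆ (c : ℂ) (_ : 1 ≤ c.re), adEigenspace S c) : IsNilpotent (ad ℂ 𝔤 (N + X)) := by
  obtain ⟨M, hM⟩ : ∃ M : ℕ, ∀ c, adEigenspace S c ≠ ⊥ → |c.re| ≤ M := by
    have hfin := (ad ℂ 𝔤 S).finite_hasEigenvalue.image (fun c : ℂ => |c.re|)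
    obtain ⟨R, hR⟩ := hfin.bddAbove
    obtain ⟨M, hM⟩ := exists_nat_ge R
    refine ⟨M, fun c hc => (hR ⟨c, ?_, rfl⟩).trans hM⟩
    rw [adEigenspace_eq] at hc
    exact hc
  -- The filtration by real part of the eigenvalue. All real parts lie in [-M, M], so F 0 is
  -- everything and F (2M + 1) is zero; N preserves each step and X raises it.
  let F : ℕ → Submodule ℂ 𝔤 := fun k => ⨆ (c : ℂ) (_ : (k : ℝ) - M ≤ c.re), adEigenspace S c
  have hmem : ∀ {k : ℕ} {c : ℂ} {x : 𝔤}, (k : ℝ) - M ≤ c.re → x ∈ adEigenspace S c → x ∈ F k :=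
    fun {k c x} hc hx => Submodule.mem_iSup_of_mem c (Submodule.mem_iSup_of_mem hc hx)
  have hNS : N ∈ adEigenspace S 0 := by rw [mem_adEigenspace, hSN, zero_smul]
  refine isNilpotent_of_filtration hN F (m := 2 * M + 1) ?_ ?_ ?_ ?_ ?_
  · rw [eq_top_iff, ← hS]
    refine iSup_le fun c x hx => ?_
    by_cases hc : adEigenspace S c = ⊥
    · rw [hc, Submodule.mem_bot] at hx
      rw [hx]; exact zero_mem _
    · refine hmem ?_ hx
      have := abs_le.1 (hM c hc)
      simpa using this.1
  · rw [eq_bot_iff]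
    refine iSup₂_le fun c hc => ?_
    by_contra hne
    have := abs_le.1 (hM c fun h => hne (h ▸ le_rfl))
    push_cast at hc
    linarith
  · intro k
    have : F k ≤ (F k).comap (ad ℂ 𝔤 N) := by
      refine iSup₂_le fun c hc x hx => ?_
      have h1 := lie_mem_adEigenspace hNS hx
      rw [zero_add] at h1
      exact hmem hc h1
    exact this
  · intro k
    refine iSup₂_le fun c hc x hx => hmem (le_trans ?_ hc) hx
    push_cast
    linarith
  · intro k x hx
    rw [map_add, LinearMap.add_apply, add_sub_cancel_left]
    have hF : F k ≤ (F (k + 1)).comap (ad ℂ 𝔤 X) := by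
      refine iSup₂_le fun c hc y hy => ?_
      have hle : (⨆ (c : ℂ) (_ : 1 ≤ c.re), adEigenspace S c) ≤ (F (k + 1)).comap (ad ℂ 𝔤 y) := by
        refine iSup₂_le fun d hd z hz => hmem ?_ (lie_mem_adEigenspace hy hz)
        push_cast
        rw [Complex.add_re]
        linarith
      have h1 := neg_mem (hle hX)
      rw [Submodule.mem_comap, ad_apply, lie_neg, lie_skew] at h1
      exact h1
    exact hF hx

end Grading

/-! ### The grading by the coroot of θ -/

section Roots

open LieAlgebra LieAlgebra.IsKilling LieModule

variable {𝔤 : Type*} [LieRing 𝔤] [LieAlgebra ℂ 𝔤] [FiniteDimensional ℂ 𝔤] [IsKilling ℂ 𝔤]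
  {H : LieSubalgebra ℂ 𝔤} [H.IsCartanSubalgebra]

omit [IsKilling ℂ 𝔤] in
theorem iSup_rootSpace_eq_top :
    ⨆ χ : Weight ℂ H 𝔤, (rootSpace H (χ : H → ℂ)).toSubmodule = ⊤ := by
  rw [← LieSubmodule.iSup_toSubmodule, iSup_genWeightSpace_eq_top']
  rfl

theorem rootSpace_le_adEigenspace (χ : H → ℂ) (h : H) :
    (rootSpace H χ).toSubmodule ≤ adEigenspace (h : 𝔤) (χ h) := fun _ hx =>
  lie_eq_smul_of_mem_rootSpace hx h

theorem iSup_adEigenspace_cartan (h : H) : ⨆ c, adEigenspace (h : 𝔤) c = ⊤ := by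
  rw [eq_top_iff, ← iSup_rootSpace_eq_top (H := H)]
  exact iSup_le fun χ => (rootSpace_le_adEigenspace χ h).trans (le_iSup _ _)

/-- In the list of possible pairs of pairings of a reduced crystallographic root system, symmetry
leaves only equal entries of absolute value at most 2, and the pair (2, 2) occurs only for equal
roots. -/
theorem weight_apply_coroot_of_isSimplyLaced (hsl : IsSimplyLaced (rootSystem H)) (θ : H.root)
    (χ : Weight ℂ H 𝔤) :
    χ (coroot θ.1) ∈ ({-2, -1, 0, 1, 2} : Finset ℂ) ∧ (χ (coroot θ.1) = 2 → χ = θ.1) := by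
  by_cases hχ : χ.IsZero
  · have h0 : χ (coroot θ.1) = 0 := by rw [hχ.eq]; rfl
    rw [h0]
    simp
  · have hχ' : χ ∈ H.root := by simpa using hχ
    have h1 : χ (coroot θ.1) = (rootSystem H).pairing ⟨χ, hχ'⟩ θ := rfl
    have h2 := (rootSystem H).pairingIn_pairingIn_mem_set_of_isCrystal_of_isRed ⟨χ, hχ'⟩ θ
    have h3 : (rootSystem H).pairingIn ℤ ⟨χ, hχ'⟩ θ = (rootSystem H).pairingIn ℤ θ ⟨χ, hχ'⟩ := by
      have := hsl ⟨χ, hχ'⟩ θ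
      rw [← (rootSystem H).algebraMap_pairingIn ℤ, ← (rootSystem H).algebraMap_pairingIn ℤ] at this
      exact_mod_cast this
    have h4 := (rootSystem H).pairingIn_two_two_iff ℤ ⟨χ, hχ'⟩ θ
    rw [h1, ← (rootSystem H).algebraMap_pairingIn ℤ]
    rw [← h3] at h2 h4
    generalize (rootSystem H).pairingIn ℤ ⟨χ, hχ'⟩ θ = z at h2 h4
    have h5 : z = -2 ∨ z = -1 ∨ z = 0 ∨ z = 1 ∨ z = 2 := by
      simp only [Set.mem_insert_iff, Set.mem_singleton_iff, Prod.mk.injEq] at h2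
      omega
    refine ⟨by rcases h5 with rfl | rfl | rfl | rfl | rfl <;> simp, fun hz => ?_⟩
    have hz2 : z = 2 := by
      have : (z : ℂ) = 2 := by simpa using hz
      exact_mod_cast this
    exact congrArg Subtype.val (h4.1 ⟨hz2, hz2⟩)

theorem iSup_adEigenspace_coroot (hsl : IsSimplyLaced (rootSystem H)) (θ : H.root) :
    ⨆ c ∈ ({-2, -1, 0, 1, 2} : Finset ℂ), adEigenspace ((coroot θ.1 : H) : 𝔤) c = ⊤ := by
  rw [eq_top_iff, ← iSup_rootSpace_eq_top (H := H)]
  exact iSup_le fun χ => (rootSpace_le_adEigenspace χ _).trans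
    (le_iSup₂_of_le _ (weight_apply_coroot_of_isSimplyLaced hsl θ χ).1 le_rfl)

/-- Only the weight θ takes the value 2 on its coroot, so the top piece of the grading is at most a
line. -/
theorem adEigenspace_coroot_two_le (hsl : IsSimplyLaced (rootSystem H)) (θ : H.root) :
    adEigenspace ((coroot θ.1 : H) : 𝔤) 2 ≤ (rootSpace H (θ.1 : H → ℂ)).toSubmodule := by
  refine (adEigenspace_le_iSup (w := fun χ : Weight ℂ H 𝔤 => χ (coroot θ.1))
    (fun χ => rootSpace_le_adEigenspace χ (coroot θ.1)) iSup_rootSpace_eq_top 2).trans ?_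
  refine iSup₂_le fun χ hχ => ?_
  rw [(weight_apply_coroot_of_isSimplyLaced hsl θ χ).2 hχ]

/-- An element of the Cartan subalgebra on which each root takes the value of its height. -/
theorem exists_cartan_height (B : (rootSystem H).Base) :
    ∃ h : H, ∀ i : H.root, i.1 h = (B.height i : ℂ) := by
  let φ : Module.Dual ℂ (Module.Dual ℂ H) := B.toWeightBasis.constr ℂ fun _ => (1 : ℂ)
  refine ⟨(Module.evalEquiv ℂ H).symm φ, fun i => ?_⟩
  obtain ⟨f, -, -, hf⟩ := B.exists_root_eq_sum_int i
  have h1 : φ ((rootSystem H).root i) = (B.height i : ℂ) := by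
    rw [RootPairing.Base.height_eq_sum hf, hf, map_sum, Int.cast_sum]
    refine Finset.sum_congr rfl fun j hj => ?_
    have h2 : φ ((rootSystem H).root j) = 1 := by
      have := B.toWeightBasis.constr_basis ℂ (fun _ => (1 : ℂ)) ⟨j, hj⟩
      rwa [RootPairing.Base.toWeightBasis_apply] at this
    rw [map_zsmul, h2]
    simp
  rw [← h1]
  exact Module.apply_evalEquiv_symm_apply ℂ H ((rootSystem H).root i) φ

/-- The height element of the Cartan subalgebra has eigenvalue at least 1 on each positive root
space, so `isNilpotent_ad_add` applies with N = 0. -/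
theorem isNilpotent_ad_of_mem_nPlus (B : (rootSystem H).Base) {x : 𝔤} (hx : x ∈ nPlus B) :
    IsNilpotent (ad ℂ 𝔤 x) := by
  obtain ⟨h, hh⟩ := exists_cartan_height B
  rw [← zero_add x]
  refine isNilpotent_ad_add (S := (h : 𝔤)) (iSup_adEigenspace_cartan h) (lie_zero _) ?_ ?_
  · rw [map_zero]; exact IsNilpotent.zero
  · refine (iSup_le fun i => ?_ : nPlus B ≤ _) hx
    refine (rootSpace_le_adEigenspace _ h).trans (le_iSup₂_of_le (i.1.1 h) ?_ le_rfl)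
    rw [hh i.1, Complex.intCast_re]
    exact_mod_cast Int.add_one_le_of_lt i.2

/-- `ad x` preserves the root line of θ, so it acts there by a scalar, which nilpotency forces to be
0. -/
theorem lie_eq_zero_of_mem_adEigenspace_coroot_two (hsl : IsSimplyLaced (rootSystem H))
    (θ : H.root) {x y : 𝔤} (hx : IsNilpotent (ad ℂ 𝔤 x))
    (hx0 : x ∈ adEigenspace ((coroot θ.1 : H) : 𝔤) 0)
    (hy : y ∈ adEigenspace ((coroot θ.1 : H) : 𝔤) 2) : ⁅x, y⁆ = 0 := by
  have hθ : θ.1.IsNonZero := (LieSubalgebra.isNonZero_coe_root θ)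
  by_cases hy0 : y = 0
  · rw [hy0, lie_zero]
  have hxy := lie_mem_adEigenspace hx0 hy
  rw [zero_add] at hxy
  obtain ⟨c, hc⟩ := (finrank_eq_one_iff_of_nonzero'
    (⟨y, adEigenspace_coroot_two_le hsl θ hy⟩ : rootSpace H θ.1) (by simpa using hy0)).1
    (finrank_rootSpace_eq_one θ.1 hθ) ⟨⁅x, y⁆, adEigenspace_coroot_two_le hsl θ hxy⟩
  have hc' : ad ℂ 𝔤 x y = c • y := (congrArg Subtype.val hc).symm
  obtain ⟨n, hn⟩ := hx
  have hpow : ∀ k : ℕ, ((ad ℂ 𝔤 x) ^ k) y = c ^ k • y := by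
    intro k
    induction k with
    | zero => simp
    | succ k ih => rw [pow_succ', Module.End.mul_apply, ih, map_smul, hc', smul_smul, pow_succ]
  have h1 := hpow n
  rw [hn, LinearMap.zero_apply] at h1
  have hc0 : c = 0 := eq_zero_of_pow_eq_zero ((smul_eq_zero.1 h1.symm).resolve_right hy0)
  rw [ad_apply, hc0, zero_smul] at hc'
  exact hc'

theorem exists_isSl2Triple_coroot (θ : H.root) :
    ∃ e f : 𝔤, IsSl2Triple ((coroot θ.1 : H) : 𝔤) e f := by
  have hθ : θ.1.IsNonZero := (LieSubalgebra.isNonZero_coe_root θ)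
  obtain ⟨h, e, f, t, he, hf⟩ := exists_isSl2Triple_of_weight_isNonZero hθ
  exact ⟨e, f, t.h_eq_coroot hθ he hf ▸ t⟩

end Roots

/-! ### Normal form of the residue -/

section Conjugation

open LieAlgebra

variable {𝔤 : Type*} [LieRing 𝔤] [LieAlgebra ℂ 𝔤]

/-- The exponential of an `ad`-nilpotent element, as an automorphism, on vectors killed by the third
power. -/
theorem exists_exp_ad {n : 𝔤} (hn : IsNilpotent (ad ℂ 𝔤 n)) :
    ∃ σ : 𝔤 ≃ₗ⁅ℂ⁆ 𝔤, ∀ x, ⁅n, ⁅n, ⁅n, x⁆⁆⁆ = 0 →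
      σ x = x + ⁅n, x⁆ + (2⁻¹ : ℂ) • ⁅n, ⁅n, x⁆⁆ := by
  -- Exponentials of nilpotent derivations are taken over ℚ, so scalars are restricted from ℂ.
  let : Module ℚ 𝔤 := Module.compHom 𝔤 (algebraMap ℚ ℂ)
  have hsm : ∀ (q : ℚ) (x : 𝔤), q • x = (q : ℂ) • x := fun q x => rfl
  let : LieAlgebra ℚ 𝔤 := { lie_smul := fun q x y => by rw [hsm, hsm, lie_smul] }
  have hn' : IsNilpotent (LieDerivation.ad ℂ 𝔤 n).toLinearMap := by
    have h := LieDerivation.coe_ad_apply_eq_ad_apply (R := ℂ) n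
    exact h ▸ hn
  refine ⟨LieDerivation.exp _ hn', fun x hx => ?_⟩
  rw [LieDerivation.exp_map_apply]
  have := IsNilpotent.exp_smul_eq_sum (a := (LieDerivation.ad ℂ 𝔤 n).toLinearMap) (m := x) (k := 3)
    (by simpa [pow_succ] using hx) hn'
  rw [Module.End.smul_def] at this
  rw [this]
  simp [Finset.sum_range_succ, pow_succ, hsm]

/-- The residue `-S + η₀ + η₁ + η₂` is conjugate to `-S + η₀`. -/
theorem exists_conj_residue [FiniteDimensional ℂ 𝔤] {S η₀ η₁ η₂ : 𝔤}
    (hS : ⨆ c ∈ ({-2, -1, 0, 1, 2} : Finset ℂ), adEigenspace S c = ⊤)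
    (hη₀ : η₀ ∈ adEigenspace S 0) (hnil : IsNilpotent (ad ℂ 𝔤 η₀))
    (hη₀' : ∀ y ∈ adEigenspace S 2, ⁅η₀, y⁆ = 0)
    (hη₁ : η₁ ∈ adEigenspace S 1) (hη₂ : η₂ ∈ adEigenspace S 2) :
    ∃ σ : 𝔤 ≃ₗ⁅ℂ⁆ 𝔤, σ (-S + η₀) = -S + η₀ + η₁ + η₂ := by
  have hS' : ⨆ c, adEigenspace S c = ⊤ := by
    rw [eq_top_iff, ← hS]
    exact iSup₂_le_iSup _ _
  have h3 : ∀ x y : 𝔤, x ∈ adEigenspace S 1 → y ∈ adEigenspace S 2 → ⁅x, y⁆ = 0 := by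
    intro x y hx hy
    have := lie_mem_adEigenspace hx hy
    exact eq_zero_of_mem_adEigenspace hS (by norm_num) this
  have h4 : ∀ x y : 𝔤, x ∈ adEigenspace S 2 → y ∈ adEigenspace S 2 → ⁅x, y⁆ = 0 := by
    intro x y hx hy
    have := lie_mem_adEigenspace hx hy
    exact eq_zero_of_mem_adEigenspace hS (by norm_num) this
  -- Matching degree 1 requires (1 - ad η₀) n₁ = η₁, solved by a finite geometric series.
  obtain ⟨n₁, hn₁, hn₁'⟩ : ∃ n₁ ∈ adEigenspace S 1, n₁ - ⁅η₀, n₁⁆ = η₁ := by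
    obtain ⟨m, hm⟩ := hnil
    refine ⟨(∑ k ∈ Finset.range m, (ad ℂ 𝔤 η₀) ^ k) η₁, ?_, ?_⟩
    · rw [LinearMap.sum_apply]
      refine Submodule.sum_mem _ fun k hk => ?_
      clear hk
      induction k with
      | zero => simpa using hη₁
      | succ k ih =>
        rw [pow_succ', Module.End.mul_apply, ad_apply]
        simpa using lie_mem_adEigenspace hη₀ ih
    · have h1 := congrArg (fun T : Module.End ℂ 𝔤 => T η₁) (mul_neg_geom_sum (ad ℂ 𝔤 η₀) m)
      rwa [hm, sub_zero, Module.End.mul_apply, LinearMap.sub_apply, Module.End.one_apply,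
        Module.End.one_apply, ad_apply] at h1
  have hnη : ⁅n₁, η₁⁆ ∈ adEigenspace S 2 := by
    have := lie_mem_adEigenspace hn₁ hη₁
    norm_num at this
    exact this
  -- Matching degree 2: the linear term 2 n₂ and the quadratic term [n₁, η₁] / 2 must add up to η₂.
  obtain ⟨n₂, hn₂S, hn₂⟩ : ∃ n₂ ∈ adEigenspace S 2, (2 : ℂ) • n₂ = η₂ - (2⁻¹ : ℂ) • ⁅n₁, η₁⁆ :=
    ⟨(2⁻¹ : ℂ) • (η₂ - (2⁻¹ : ℂ) • ⁅n₁, η₁⁆), Submodule.smul_mem _ _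
      (sub_mem hη₂ (Submodule.smul_mem _ _ hnη)), by module⟩
  have hnil' : IsNilpotent (ad ℂ 𝔤 (n₁ + n₂)) := by
    rw [← zero_add (n₁ + n₂)]
    refine isNilpotent_ad_add hS' (lie_zero _) (by rw [map_zero]; exact IsNilpotent.zero) ?_
    refine add_mem (Submodule.mem_iSup_of_mem 1 (Submodule.mem_iSup_of_mem ?_ hn₁))
      (Submodule.mem_iSup_of_mem 2 (Submodule.mem_iSup_of_mem ?_ hn₂S)) <;> norm_num
  obtain ⟨σ, hσ⟩ := exists_exp_ad hnil'
  have hSn₁ : ⁅n₁, S⁆ = -n₁ := by rw [← lie_skew, hn₁, one_smul]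
  have hSn₂ : ⁅n₂, S⁆ = -((2 : ℂ) • n₂) := by rw [← lie_skew, hn₂S]
  have hηn₁ : ⁅n₁, η₀⁆ = η₁ - n₁ := by rw [← lie_skew, ← hn₁']; abel
  have hηn₂ : ⁅n₂, η₀⁆ = 0 := by rw [← lie_skew, hη₀' _ hn₂S, neg_zero]
  have e1 : ⁅n₁ + n₂, -S + η₀⁆ = η₁ + (2 : ℂ) • n₂ := by
    rw [add_lie, lie_add, lie_add, lie_neg, lie_neg, hSn₁, hSn₂, hηn₁, hηn₂]
    abel
  have e2 : ⁅n₁ + n₂, ⁅n₁ + n₂, -S + η₀⁆⁆ = ⁅n₁, η₁⁆ := by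
    rw [e1, add_lie, lie_add, lie_add, lie_smul, lie_smul, h3 _ _ hn₁ hn₂S, h4 _ _ hn₂S hn₂S,
      ← lie_skew n₂, h3 _ _ hη₁ hn₂S]
    simp
  refine ⟨σ, ?_⟩
  rw [hσ, e2, e1, hn₂]
  · module
  · rw [e2, add_lie, h3 _ _ hn₁ hnη, h4 _ _ hn₂S hnη, add_zero]

end Conjugation

/-! ### Holomorphic vector-valued functions through coordinates -/

section Vector

variable {E F : Type*} [AddCommGroup E] [Module ℂ E] [AddCommGroup F] [Module ℂ F]

/-- A function with values in a finite-dimensional space is holomorphic on `s`. -/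
def VecDifferentiableOn (f : ℂ → E) (s : Set ℂ) : Prop :=
  ∀ ℓ : Module.Dual ℂ E, DifferentiableOn ℂ (fun x => ℓ (f x)) s

theorem VecDifferentiableOn.map {f : ℂ → E} {s : Set ℂ} (h : VecDifferentiableOn f s)
    (T : E →ₗ[ℂ] F) : VecDifferentiableOn (fun x => T (f x)) s := fun ℓ => h (ℓ ∘ₗ T)

theorem VecDifferentiableOn.add {f g : ℂ → E} {s : Set ℂ} (hf : VecDifferentiableOn f s)
    (hg : VecDifferentiableOn g s) : VecDifferentiableOn (fun x => f x + g x) s := fun ℓ => by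
  simpa using! (hf ℓ).add (hg ℓ)

theorem VecDifferentiableOn.sub {f g : ℂ → E} {s : Set ℂ} (hf : VecDifferentiableOn f s)
    (hg : VecDifferentiableOn g s) : VecDifferentiableOn (fun x => f x - g x) s := fun ℓ => by
  simpa using! (hf ℓ).sub (hg ℓ)

theorem VecDifferentiableOn.smul {f : ℂ → E} {c : ℂ → ℂ} {s : Set ℂ} (hc : DifferentiableOn ℂ c s)
    (hf : VecDifferentiableOn f s) : VecDifferentiableOn (fun x => c x • f x) s := fun ℓ => by
  simpa using! hc.mul (hf ℓ)

theorem vecDifferentiableOn_const (v : E) (s : Set ℂ) : VecDifferentiableOn (fun _ => v) s :=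
  fun _ => differentiableOn_const _

theorem VecDifferentiableOn.differentiableOn {E : Type*} [NormedAddCommGroup E] [NormedSpace ℂ E]
    [FiniteDimensional ℂ E] {f : ℂ → E} {s : Set ℂ} (hf : VecDifferentiableOn f s) :
    DifferentiableOn ℂ f s := by
  let e := (Module.finBasis ℂ E).equivFun.toContinuousLinearEquiv
  rw [← e.comp_differentiableOn_iff, differentiableOn_pi]
  exact fun i => hf ((Module.finBasis ℂ E).coord i)

theorem hasVecDerivAt_iff {E : Type*} [NormedAddCommGroup E] [NormedSpace ℂ E]
    [FiniteDimensional ℂ E] {f : ℂ → E} {v : E} {x : ℂ} :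
    HasVecDerivAt f v x ↔ HasDerivAt f v x := by
  refine ⟨fun h => ?_, fun h ℓ => ?_⟩
  · let e := (Module.finBasis ℂ E).equivFun.toContinuousLinearEquiv
    have h1 : HasDerivAt (fun y => e (f y)) (e v) x :=
      hasDerivAt_pi.2 fun i => h ((Module.finBasis ℂ E).coord i)
    have h2 := (e.symm : (Fin _ → ℂ) →L[ℂ] E).hasFDerivAt.comp_hasDerivAt x h1
    simpa [Function.comp_def] using! h2
  · exact (LinearMap.toContinuousLinearMap ℓ).hasFDerivAt.comp_hasDerivAt x h

/-- Second order Taylor expansion of a holomorphic vector valued function. -/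
theorem exists_taylor_two [FiniteDimensional ℂ E] {A : ℂ → E} {r : ℝ} (hr : 0 < r)
    (hA : VecDifferentiableOn A (Metric.ball 0 r)) {b : E} (hb : HasVecDerivAt A b 0) :
    ∃ A₂ : ℂ → E, VecDifferentiableOn A₂ (Metric.ball 0 r) ∧
      ∀ x, A x = A 0 + x • b + x ^ 2 • A₂ x := by
  let e := (Module.finBasis ℂ E).equivFun
  have hnhds : Metric.ball (0 : ℂ) r ∈ nhds 0 := Metric.ball_mem_nhds 0 hr
  let f : ℂ → Fin (Module.finrank ℂ E) → ℂ := fun x => e (A x)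
  have hf : DifferentiableOn ℂ f (Metric.ball 0 r) := by
    rw [differentiableOn_pi]
    exact fun i => hA ((Module.finBasis ℂ E).coord i)
  have hf' : deriv f 0 = e b :=
    (hasDerivAt_pi.2 fun i => hb ((Module.finBasis ℂ E).coord i)).deriv
  have h1 := (Complex.differentiableOn_dslope hnhds).2 hf
  have h2 := (Complex.differentiableOn_dslope hnhds).2 h1
  -- The remainder is the iterated difference quotient at 0, holomorphic by removability of the
  -- singularity.
  refine ⟨fun x => e.symm (dslope (dslope f 0) 0 x), fun ℓ => ?_, fun x => ?_⟩
  · exact (LinearMap.toContinuousLinearMap (ℓ ∘ₗ e.symm.toLinearMap)).differentiable.comp_differentiableOn h2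
  · have e1 := sub_smul_dslope f 0 x
    have e2 := sub_smul_dslope (dslope f 0) 0 x
    rw [dslope_same, hf', sub_zero] at e2
    rw [sub_zero] at e1
    apply e.injective
    rw [map_add, map_add, map_smul, map_smul, LinearEquiv.apply_symm_apply, pow_two, mul_smul, e2,
      smul_sub, e1]
    change f x = f 0 + _ + _
    abel

end Vector

/-! ### Single-valuedness for a nilpotent residue, in the variable t = log x -/

section Solutions

variable {V : Type*} [NormedAddCommGroup V] [NormedSpace ℂ V]

/-- Solutions of `dφ/dt = -M(t) φ` on the half plane `|e^t| < r`. -/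
def IsExpSolution (M : ℂ → V →L[ℂ] V) (r : ℝ) (φ : ℂ → V) : Prop :=
  ∀ t : ℂ, ‖Complex.exp t‖ < r → HasDerivAt φ (-(M t (φ t))) t

/-- All solutions of `dφ/dt = -M(t) φ` on the half plane `|e^t| < r` are `2πi`-periodic. -/
def AllPeriodic (M : ℂ → V →L[ℂ] V) (r : ℝ) : Prop :=
  ∀ φ, IsExpSolution M r φ → ∀ t : ℂ, ‖Complex.exp t‖ < r → φ (t + 2 * Real.pi * Complex.I) = φ t

/-- The domain is a left half plane; its connectedness makes functions with zero derivative
constant. -/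
theorem convex_expHalfPlane (r : ℝ) : Convex ℝ {t : ℂ | ‖Complex.exp t‖ < r} := by
  rcases le_or_gt r 0 with hr | hr
  · have : {t : ℂ | ‖Complex.exp t‖ < r} = ∅ := by
      ext t
      simpa using hr.trans (norm_nonneg _)
    rw [this]
    exact convex_empty
  · have : {t : ℂ | ‖Complex.exp t‖ < r} = {t : ℂ | t.re < Real.log r} := by
      ext t
      simp [Complex.norm_exp, Real.lt_log_iff_exp_lt hr]
    rw [this]
    exact convex_halfSpace_re_lt _

theorem isOpen_expHalfPlane (r : ℝ) : IsOpen {t : ℂ | ‖Complex.exp t‖ < r} :=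
  isOpen_lt (by fun_prop) continuous_const

theorem exp_add_two_pi_I (t : ℂ) : Complex.exp (t + 2 * Real.pi * Complex.I) = Complex.exp t := by
  rw [Complex.exp_add, Complex.exp_two_pi_mul_I, mul_one]

variable [CompleteSpace V]

/-- Left and right multiplication by C commute and are both nilpotent. This is the non-resonance
condition of `exists_frobenius_solution`. -/
theorem isNilpotent_commutator {𝒜 : Type*} [NormedRing 𝒜] [NormedAlgebra ℂ 𝒜] {C : 𝒜}
    (hC : IsNilpotent C) :
    IsNilpotent (ContinuousLinearMap.mul ℂ 𝒜 C - (ContinuousLinearMap.mul ℂ 𝒜).flip C) := by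
  obtain ⟨m, hm⟩ := hC
  refine Commute.isNilpotent_sub ?_ ⟨m, ?_⟩ ⟨m, ?_⟩
  · ext x
    simp [mul_assoc]
  · have : ∀ k : ℕ, ∀ x, ((ContinuousLinearMap.mul ℂ 𝒜 C) ^ k) x = C ^ k * x := by
      intro k x
      induction k with
      | zero => simp
      | succ k ih => rw [pow_succ', mul_apply_eq_comp, ih, pow_succ', mul_assoc]; rfl
    ext x
    simp [this, hm]
  · have : ∀ k : ℕ, ∀ x, (((ContinuousLinearMap.mul ℂ 𝒜).flip C) ^ k) x = x * C ^ k := by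
      intro k x
      induction k with
      | zero => simp
      | succ k ih => rw [pow_succ', mul_apply_eq_comp, ih, pow_succ, ← mul_assoc]; rfl
    ext x
    simp [this, hm]

/-- If the residue `C` is nilpotent and all solutions are single-valued, then `C = 0`. -/
theorem eq_zero_of_allPeriodic {C : V →L[ℂ] V} (hC : IsNilpotent C) {H : ℂ → V →L[ℂ] V} {r : ℝ}
    (hr : 0 < r) (hH : DifferentiableOn ℂ H (Metric.ball 0 r))
    (hper : AllPeriodic (fun t => C + Complex.exp t • H (Complex.exp t)) r) : C = 0 := by
  by_contra hC0
  obtain ⟨P, P', hP0, hP⟩ := exists_frobenius_solution (isNilpotent_commutator hC) hH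
  -- With C² v = 0 the vector exp(-tC) v is just v - t C v, and φ = P(e^t) exp(-tC) v is a solution
  -- containing a logarithm.
  obtain ⟨v, hv, hv2⟩ : ∃ v, C v ≠ 0 ∧ C (C v) = 0 := by
    obtain ⟨k, hk, hk'⟩ := Nat.exists_not_and_succ_of_not_zero_of_exists
      (p := fun k => C ^ (k + 1) = 0) (by simpa using hC0)
      (by obtain ⟨m, hm⟩ := hC; exact ⟨m, by rw [pow_succ, hm, zero_mul]⟩)
    obtain ⟨w, hw⟩ : ∃ w, (C ^ (k + 1)) w ≠ 0 := by
      by_contra! h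
      exact hk (ContinuousLinearMap.ext h)
    refine ⟨(C ^ k) w, ?_, ?_⟩
    · rwa [pow_succ', mul_apply_eq_comp] at hw
    · rw [← mul_apply_eq_comp, ← mul_apply_eq_comp, mul_assoc, ← pow_succ', ← pow_succ', hk']
      rfl
  let φ : ℂ → V := fun t => P (Complex.exp t) (v - t • C v)
  have hφ : IsExpSolution (fun t => C + Complex.exp t • H (Complex.exp t)) r φ := by
    intro t ht
    obtain ⟨hd, heq⟩ := hP (Complex.exp t) (mem_ball_zero_iff.2 ht)
    have h1 : HasDerivAt (fun t => P (Complex.exp t)) (Complex.exp t • P' (Complex.exp t)) t :=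
      hd.scomp t (Complex.hasDerivAt_exp t)
    have h2 : HasDerivAt (fun t : ℂ => v - t • C v) (-C v) t := by
      simpa using! ((hasDerivAt_id t).smul_const (C v)).const_sub v
    have h3 := h1.clm_apply h2
    rw [heq] at h3
    convert! h3 using 1
    simp only [φ, sub_apply, add_apply, smul_apply, mul_apply_eq_comp, map_sub, map_smul, hv2,
      map_neg, map_zero]
    module
  -- One turn changes φ by -2πi P(z) C v, so periodicity makes this vanish for z ≠ 0. The limit z →
  -- 0, where P = 1, then contradicts C v ≠ 0.
  have hzero : ∀ z ∈ Metric.ball (0 : ℂ) r, z ≠ 0 → P z (C v) = 0 := by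
    intro z hz hz0
    have ht : ‖Complex.exp (Complex.log z)‖ < r := by
      rw [Complex.exp_log hz0]; exact mem_ball_zero_iff.1 hz
    have h1 := hper φ hφ _ ht
    simp only [φ] at h1
    rw [exp_add_two_pi_I, Complex.exp_log hz0, ← sub_eq_zero, ← map_sub] at h1
    have h2 : v - (Complex.log z + 2 * Real.pi * Complex.I) • C v - (v - Complex.log z • C v) =
        -(2 * Real.pi * Complex.I) • C v := by module
    rw [h2, map_smul] at h1
    exact (smul_eq_zero.1 h1).resolve_left (neg_ne_zero.2 Complex.two_pi_I_ne_zero)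
  have hlim : Filter.Tendsto (fun z => P z (C v)) (nhdsWithin 0 {0}ᶜ) (nhds (P 0 (C v))) := by
    have h1 : ContinuousAt P 0 := (hP 0 (Metric.mem_ball_self hr)).1.continuousAt
    exact (h1.clm_apply continuousAt_const).tendsto.mono_left nhdsWithin_le_nhds
  have hlim0 : Filter.Tendsto (fun z => P z (C v)) (nhdsWithin 0 {0}ᶜ) (nhds 0) := by
    refine Filter.Tendsto.congr' ?_ tendsto_const_nhds
    filter_upwards [self_mem_nhdsWithin,
      nhdsWithin_le_nhds (Metric.ball_mem_nhds (0 : ℂ) hr)] with z hz0 hz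
    exact (hzero z hz hz0).symm
  have := tendsto_nhds_unique hlim hlim0
  rw [hP0] at this
  exact hv this

theorem hasDerivAt_ringInverse {𝒜 : Type*} [NormedRing 𝒜] [NormedAlgebra ℂ 𝒜] [CompleteSpace 𝒜]
    {P : ℂ → 𝒜} {P' : 𝒜} {s : ℂ} (hP : HasDerivAt P P' s) (hu : IsUnit (P s)) :
    HasDerivAt (fun t => Ring.inverse (P t)) (-(Ring.inverse (P s) * P' * Ring.inverse (P s))) s := by
  obtain ⟨u, hu⟩ := hu
  have h2 := hasFDerivAt_ringInverse (𝕜 := ℂ) u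
  have h3 : (↑u⁻¹ : 𝒜) = Ring.inverse (P s) := by rw [← hu, Ring.inverse_unit]
  rw [hu, h3] at h2
  exact h2.comp_hasDerivAt s hP

/-- Near a regular point all solutions are single-valued. -/
theorem exists_allPeriodic {H : ℂ → V →L[ℂ] V} {r : ℝ} (hr : 0 < r)
    (hH : DifferentiableOn ℂ H (Metric.ball 0 r)) :
    ∃ r', 0 < r' ∧ r' ≤ r ∧ AllPeriodic (fun t => Complex.exp t • H (Complex.exp t)) r' := by
  obtain ⟨P, P', hP0, hP⟩ := exists_frobenius_solution
    (isNilpotent_commutator (IsNilpotent.zero (R := V →L[ℂ] V))) hH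
  have hcont : ContinuousAt P 0 := (hP 0 (Metric.mem_ball_self hr)).1.continuousAt
  have hunit : ∀ᶠ z in nhds (0 : ℂ), IsUnit (P z) :=
    hcont.eventually (Units.isOpen.mem_nhds (by simp [hP0]))
  obtain ⟨δ, hδ, hδu⟩ := Metric.eventually_nhds_iff_ball.1 hunit
  -- P comes from Frobenius' method with C = 0 and is an invertible single-valued fundamental
  -- solution on this smaller disc. Hence Y = P⁻¹ φ is constant and φ is periodic.
  refine ⟨min δ r, lt_min hδ hr, min_le_right _ _, fun φ hφ t ht => ?_⟩
  let Y : ℂ → V := fun t => Ring.inverse (P (Complex.exp t)) (φ t)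
  have hY : ∀ s, ‖Complex.exp s‖ < min δ r → HasDerivAt Y 0 s := by
    intro s hs
    have hu := hδu (Complex.exp s) (mem_ball_zero_iff.2 (hs.trans_le (min_le_left _ _)))
    obtain ⟨hd, heq⟩ := hP (Complex.exp s) (mem_ball_zero_iff.2 (hs.trans_le (min_le_right _ _)))
    have h1 : HasDerivAt (fun t => P (Complex.exp t)) (Complex.exp s • P' (Complex.exp s)) s :=
      hd.scomp s (Complex.hasDerivAt_exp s)
    have h3 := (hasDerivAt_ringInverse h1 hu).clm_apply (hφ s hs)
    rw [heq, mul_zero, zero_mul, sub_self, zero_sub, mul_neg, neg_mul, neg_neg, mul_smul_comm,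
      smul_mul_assoc, mul_assoc, mul_assoc, Ring.mul_inverse_cancel _ hu, mul_one, map_neg,
      ← mul_apply_eq_comp, mul_smul_comm, add_neg_cancel] at h3
    exact h3
  have hS := (convex_expHalfPlane (min δ r)).isPreconnected
  have hconst : Y (t + 2 * Real.pi * Complex.I) = Y t :=
    (isOpen_expHalfPlane (min δ r)).is_const_of_deriv_eq_zero hS
      (fun s hs => (hY s hs).differentiableAt.differentiableWithinAt) (fun s hs => (hY s hs).deriv)
      (by rw [Set.mem_ofPred_eq, exp_add_two_pi_I]; exact ht) ht
  simp only [Y] at hconst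
  rw [exp_add_two_pi_I] at hconst
  have hu := hδu (Complex.exp t) (mem_ball_zero_iff.2 (ht.trans_le (min_le_left _ _)))
  have h6 := congrArg (P (Complex.exp t)) hconst
  rwa [← mul_apply_eq_comp, ← mul_apply_eq_comp, Ring.mul_inverse_cancel _ hu, one_apply_eq_self,
    one_apply_eq_self] at h6

end Solutions

/-! ### Exponentials of operators -/

section Exponential

variable {𝒜 : Type*} [NormedRing 𝒜] [NormedAlgebra ℂ 𝒜] [CompleteSpace 𝒜]

open NormedSpace in
theorem exp_smul_mul_exp_neg_smul (X : 𝒜) (s : ℂ) : exp (s • X) * exp ((-s) • X) = 1 := by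
  let := NormedAlgebra.restrictScalars ℚ ℂ 𝒜
  rw [← exp_add_of_commute (((Commute.refl X).smul_left s).smul_right (-s)), ← add_smul,
    add_neg_cancel, zero_smul, exp_zero]

open NormedSpace in
theorem exp_add_smul (X : 𝒜) (s u : ℂ) : exp ((s + u) • X) = exp (s • X) * exp (u • X) := by
  let := NormedAlgebra.restrictScalars ℚ ℂ 𝒜
  rw [add_smul, exp_add_of_commute (((Commute.refl X).smul_left s).smul_right u)]

open NormedSpace in
/-- The solutions of the Lax equation `y' = [X, y]` are the conjugates by the exponential of `X`. -/
theorem exp_smul_mul_of_hasDerivAt_commutator {X : 𝒜} {y : ℂ → 𝒜}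
    (hy : ∀ s, HasDerivAt y (X * y s - y s * X) s) (s : ℂ) :
    exp (s • X) * y 0 = y s * exp (s • X) := by
  -- Undoing the conjugation gives a function with zero derivative.
  let F : ℂ → 𝒜 := fun s => exp ((-s) • X) * y s * exp (s • X)
  have hF : ∀ s, HasDerivAt F 0 s := by
    intro s
    have h1 : HasDerivAt (fun s : ℂ => exp ((-s) • X)) ((-1 : ℂ) • (exp ((-s) • X) * X)) s :=
      (hasDerivAt_exp_smul_const X (-s)).scomp s (hasDerivAt_neg s)
    have h2 := hasDerivAt_exp_smul_const' X s
    have h3 := (h1.mul (hy s)).mul h2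
    convert! h3 using 1
    simp only [Pi.mul_apply]
    rw [neg_one_smul]
    noncomm_ring
  have h0 : F s = F 0 := is_const_of_deriv_eq_zero (fun s => (hF s).differentiableAt)
    (fun s => (hF s).deriv) s 0
  have h1 : F 0 = y 0 := by simp [F]
  rw [← h1, ← h0]
  simp only [F]
  rw [← mul_assoc, ← mul_assoc, exp_smul_mul_exp_neg_smul, one_mul]

open NormedSpace in
theorem exp_smul_apply_eigenvector {V : Type*} [NormedAddCommGroup V] [NormedSpace ℂ V]
    [CompleteSpace V] {X : V →L[ℂ] V} {v : V} {m : ℂ} (hv : X v = m • v) (s : ℂ) :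
    exp (s • X) v = Complex.exp (s * m) • v := by
  let F : ℂ → V := fun s => Complex.exp (-(s * m)) • exp (s • X) v
  have hF : ∀ s, HasDerivAt F 0 s := by
    intro s
    have h1 := (hasDerivAt_exp_smul_const X s).clm_apply (hasDerivAt_const s v)
    have h2 : HasDerivAt (fun s : ℂ => Complex.exp (-(s * m))) (Complex.exp (-(s * m)) * -m) s := by
      simpa using! (((hasDerivAt_id s).mul_const m).neg).cexp
    have h3 := h2.smul h1
    convert! h3 using 1
    rw [mul_apply_eq_comp, hv, map_smul, map_zero]
    module
  have h0 : F s = F 0 := is_const_of_deriv_eq_zero (fun s => (hF s).differentiableAt)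
    (fun s => (hF s).deriv) s 0
  simp only [F, zero_mul, neg_zero, Complex.exp_zero, zero_smul, exp_zero, one_smul,
    one_apply_eq_self] at h0
  calc exp (s • X) v = Complex.exp (s * m) • Complex.exp (-(s * m)) • exp (s • X) v := by
        rw [smul_smul, ← Complex.exp_add, add_neg_cancel, Complex.exp_zero, one_smul]
    _ = Complex.exp (s * m) • v := by rw [h0]

end Exponential

/-! ### The single-valued gauge transformation -/

section Gauge

open NormedSpace

variable {V : Type*} [NormedAddCommGroup V] [NormedSpace ℂ V] [CompleteSpace V]

/-- The gauge transformation `exp(-x⁻¹ α) x ^ D`, in the variable `t = log x`. -/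
noncomputable def gauge (D α : V →L[ℂ] V) (t : ℂ) : V →L[ℂ] V :=
  exp ((-Complex.exp (-t)) • α) * exp (t • D)

/-- The inverse of `gauge`. -/
noncomputable def gaugeInv (D α : V →L[ℂ] V) (t : ℂ) : V →L[ℂ] V :=
  exp ((-t) • D) * exp (Complex.exp (-t) • α)

theorem gauge_mul_gaugeInv (D α : V →L[ℂ] V) (t : ℂ) : gauge D α t * gaugeInv D α t = 1 := by
  have h1 := exp_smul_mul_exp_neg_smul D t
  have h2 := exp_smul_mul_exp_neg_smul α (-Complex.exp (-t))
  rw [neg_neg] at h2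
  rw [gauge, gaugeInv, mul_assoc, ← mul_assoc (exp (t • D)), h1, one_mul, h2]

theorem gaugeInv_mul_gauge (D α : V →L[ℂ] V) (t : ℂ) : gaugeInv D α t * gauge D α t = 1 := by
  have h1 := exp_smul_mul_exp_neg_smul D (-t)
  have h2 := exp_smul_mul_exp_neg_smul α (Complex.exp (-t))
  rw [neg_neg] at h1
  rw [gauge, gaugeInv, mul_assoc, ← mul_assoc (exp (Complex.exp (-t) • α)), h2, one_mul, h1]

theorem hasDerivAt_gauge (D α : V →L[ℂ] V) (t : ℂ) :
    HasDerivAt (gauge D α) (Complex.exp (-t) • (α * gauge D α t) + gauge D α t * D) t := by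
  have h0 : HasDerivAt (fun t : ℂ => -Complex.exp (-t)) (Complex.exp (-t)) t := by
    simpa using! ((hasDerivAt_neg t).cexp).neg
  have h1 := (hasDerivAt_exp_smul_const' α (-Complex.exp (-t))).scomp t h0
  have h2 := h1.mul (hasDerivAt_exp_smul_const D t)
  convert! h2 using 1

theorem hasDerivAt_gaugeInv (D α : V →L[ℂ] V) (t : ℂ) :
    HasDerivAt (gaugeInv D α)
      (-(D * gaugeInv D α t) - Complex.exp (-t) • (gaugeInv D α t * α)) t := by
  have h0 : HasDerivAt (fun t : ℂ => Complex.exp (-t)) (-Complex.exp (-t)) t := by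
    simpa using! (hasDerivAt_neg t).cexp
  have h1 := (hasDerivAt_exp_smul_const α (Complex.exp (-t))).scomp t h0
  have h3 := (hasDerivAt_exp_smul_const' D (-t)).scomp t (hasDerivAt_neg t)
  have h2 := h3.mul h1
  convert! h2 using 1
  simp only [gaugeInv, Function.comp_apply, smul_mul_assoc, mul_assoc, mul_smul_comm]
  module

theorem gauge_periodic {D α : V →L[ℂ] V} (hD : exp ((2 * Real.pi * Complex.I) • D) = 1) (t : ℂ) :
    gauge D α (t + 2 * Real.pi * Complex.I) = gauge D α t := by
  have h := exp_add_smul D t (2 * Real.pi * Complex.I)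
  rw [gauge, gauge, h, hD, mul_one, Complex.exp_neg, Complex.exp_neg, exp_add_two_pi_I]

theorem gaugeInv_periodic {D α : V →L[ℂ] V} (hD : exp ((2 * Real.pi * Complex.I) • D) = 1) (t : ℂ) :
    gaugeInv D α (t + 2 * Real.pi * Complex.I) = gaugeInv D α t := by
  have h := gauge_periodic (α := α) hD t
  calc gaugeInv D α (t + 2 * Real.pi * Complex.I)
      = gaugeInv D α t * (gauge D α t * gaugeInv D α (t + 2 * Real.pi * Complex.I)) := by
        rw [← mul_assoc, gaugeInv_mul_gauge, one_mul]
    _ = gaugeInv D α t := by rw [← h, gauge_mul_gaugeInv, mul_one]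

/-- A single-valued gauge transformation preserves the triviality of the monodromy. -/
theorem allPeriodic_gauge_iff {D α : V →L[ℂ] V} {M K : ℂ → V →L[ℂ] V} {r : ℝ}
    (hD : exp ((2 * Real.pi * Complex.I) • D) = 1)
    (hG : ∀ t, ‖Complex.exp t‖ < r →
      gauge D α t * M t = (K t + Complex.exp (-t) • α) * gauge D α t) :
    AllPeriodic (fun t => D + M t) r ↔ AllPeriodic K r := by
  constructor
  · intro h φ hφ t ht
    have hψ : IsExpSolution (fun t => D + M t) r (fun t => gaugeInv D α t (φ t)) := by
      intro s hs
      have h1 := (hasDerivAt_gaugeInv D α s).clm_apply (hφ s hs)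
      convert! h1 using 1
      have h2 : M s * gaugeInv D α s = gaugeInv D α s * (K s + Complex.exp (-s) • α) := by
        calc M s * gaugeInv D α s = gaugeInv D α s * (gauge D α s * M s) * gaugeInv D α s := by
              rw [← mul_assoc (gaugeInv D α s), gaugeInv_mul_gauge, one_mul]
          _ = _ := by rw [hG s hs, mul_assoc, mul_assoc, gauge_mul_gaugeInv, mul_one]
      have h3 := congrArg (fun T : V →L[ℂ] V => T (φ s)) h2
      simp only [mul_apply_eq_comp, add_apply, smul_apply, map_add, map_smul] at h3
      simp only [add_apply, h3, sub_apply, neg_apply, mul_apply_eq_comp, smul_apply, map_neg]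
      abel
    have h4 := h _ hψ t ht
    rw [gaugeInv_periodic hD] at h4
    have h5 := congrArg (gauge D α t) h4
    rwa [← mul_apply_eq_comp, ← mul_apply_eq_comp, gauge_mul_gaugeInv, one_apply_eq_self,
      one_apply_eq_self] at h5
  · intro h ψ hψ t ht
    -- Differentiating the gauge gives x⁻¹ α on the left, which cancels the polar term in `hG`, and
    -- D on the right, which cancels the D of the original equation.
    have hφ : IsExpSolution K r (fun t => gauge D α t (ψ t)) := by
      intro s hs
      have h1 := (hasDerivAt_gauge D α s).clm_apply (hψ s hs)
      convert! h1 using 1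
      have h3 := congrArg (fun T : V →L[ℂ] V => T (ψ s)) (hG s hs)
      simp only [mul_apply_eq_comp, add_apply, smul_apply] at h3
      simp only [add_apply, mul_apply_eq_comp, smul_apply, map_neg, map_add, h3]
      abel
    have h4 := h _ hφ t ht
    rw [gauge_periodic hD] at h4
    have h5 := congrArg (gaugeInv D α t) h4
    rwa [← mul_apply_eq_comp, ← mul_apply_eq_comp, gaugeInv_mul_gauge, one_apply_eq_self,
      one_apply_eq_self] at h5

end Gauge

/-! ### The gauged connection and its residue -/

section LieGauge

open NormedSpace

variable {𝔤 : Type*} [LieRing 𝔤] [LieAlgebra ℂ 𝔤]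

section Rep

variable {V : Type*} [NormedAddCommGroup V] [NormedSpace ℂ V] [FiniteDimensional ℂ V]
  [LieRingModule 𝔤 V] [LieModule ℂ 𝔤 V]

variable (V) in
/-- The action on a finite-dimensional normed space, by continuous linear maps. -/
noncomputable def repCLM : 𝔤 →ₗ[ℂ] V →L[ℂ] V :=
  LinearMap.toContinuousLinearMap.toLinearMap ∘ₗ (LieModule.toEnd ℂ 𝔤 V : 𝔤 →ₗ[ℂ] Module.End ℂ V)

@[simp]
theorem repCLM_apply (x : 𝔤) (v : V) : repCLM V x v = ⁅x, v⁆ := rfl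

theorem repCLM_lie (x y : 𝔤) :
    repCLM V ⁅x, y⁆ = repCLM V x * repCLM V y - repCLM V y * repCLM V x := by
  ext v
  simp only [repCLM_apply, sub_apply, mul_apply_eq_comp, lie_lie]

variable [CompleteSpace V]

/-- Conjugation by x^D multiplies z by x^c, and conjugation by exp(sα) applies exp(s ad α), here a
quadratic polynomial in s. Both follow by recognizing solutions of a Lax equation. -/
theorem gauge_mul_repCLM {D α z : 𝔤} {c : ℂ} (hz : z ∈ adEigenspace D c)
    (hα : ⁅α, ⁅α, ⁅α, z⁆⁆⁆ = 0) (t : ℂ) :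
    gauge (repCLM V D) (repCLM V α) t * repCLM V z =
      repCLM V (Complex.exp (c * t) • (z + (-Complex.exp (-t)) • ⁅α, z⁆ +
        ((-Complex.exp (-t)) ^ 2 / 2) • ⁅α, ⁅α, z⁆⁆)) * gauge (repCLM V D) (repCLM V α) t := by
  have h1 : exp (t • repCLM V D) * repCLM V z =
      Complex.exp (c * t) • (repCLM V z * exp (t • repCLM V D)) := by
    have := exp_smul_mul_of_hasDerivAt_commutator (X := repCLM V D)
      (y := fun s => Complex.exp (c * s) • repCLM V z) (fun s => ?_) t
    · simpa using this
    · have h2 : HasDerivAt (fun s : ℂ => Complex.exp (c * s)) (Complex.exp (c * s) * c) s := by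
        simpa using! ((hasDerivAt_id s).const_mul c).cexp
      convert! h2.smul_const (repCLM V z) using 1
      rw [mul_smul_comm, smul_mul_assoc, ← smul_sub, ← repCLM_lie, hz, map_smul, smul_smul]
  have h2 : ∀ s : ℂ, exp (s • repCLM V α) * repCLM V z =
      repCLM V (z + s • ⁅α, z⁆ + (s ^ 2 / 2) • ⁅α, ⁅α, z⁆⁆) * exp (s • repCLM V α) := by
    intro s
    have := exp_smul_mul_of_hasDerivAt_commutator (X := repCLM V α)
      (y := fun s => repCLM V (z + s • ⁅α, z⁆ + (s ^ 2 / 2) • ⁅α, ⁅α, z⁆⁆)) (fun s => ?_) s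
    · simpa using this
    · simp only [map_add, map_smul]
      have h3 : HasDerivAt (fun s : ℂ => s ^ 2 / 2) s s := by
        simpa using! ((hasDerivAt_pow 2 s).div_const 2)
      have h4 := (((hasDerivAt_id s).smul_const (repCLM V ⁅α, z⁆)).const_add (repCLM V z)).add
        (h3.smul_const (repCLM V ⁅α, ⁅α, z⁆⁆))
      convert! h4 using 1
      rw [← map_smul, ← map_smul, ← map_add, ← map_add, ← repCLM_lie, lie_add, lie_add, lie_smul,
        lie_smul, hα, smul_zero, add_zero, map_add, map_smul, one_smul]
  rw [gauge, mul_assoc, h1, mul_smul_comm, ← mul_assoc, h2, map_smul, smul_mul_assoc, mul_assoc]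

end Rep

theorem sum_five_adEigenProj {D : 𝔤}
    (hD : ⨆ c ∈ ({-2, -1, 0, 1, 2} : Finset ℂ), adEigenspace D c = ⊤) (y : 𝔤) :
    y = adEigenProj D (-2) y + adEigenProj D (-1) y + adEigenProj D 0 y + adEigenProj D 1 y +
      adEigenProj D 2 y := by
  have := sum_adEigenProj hD y
  rw [Finset.sum_insert (by norm_num), Finset.sum_insert (by norm_num),
    Finset.sum_insert (by norm_num), Finset.sum_insert (by norm_num), Finset.sum_singleton] at this
  nth_rewrite 1 [← this]
  abel

/-- The residue of the connection after the gauge transformation. -/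
noncomputable def gaugedResidue (D N a b : 𝔤) : 𝔤 :=
  N + adEigenProj D (-1) a + adEigenProj D (-2) b - ⁅adEigenProj D (-2) a, adEigenProj D 0 a⁆

/-- The effect of the gauge transformation on the connection. -/
theorem exists_gauge [FiniteDimensional ℂ 𝔤] {D N : 𝔤}
    (hD : ⨆ c ∈ ({-2, -1, 0, 1, 2} : Finset ℂ), adEigenspace D c = ⊤)
    (hDN : N ∈ adEigenspace D 0) (hN : ∀ y ∈ adEigenspace D (-2), ⁅N, y⁆ = 0)
    {A : ℂ → 𝔤} {r : ℝ} (hr : 0 < r) (hA : VecDifferentiableOn A (Metric.ball 0 r)) {b : 𝔤}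
    (hb : HasVecDerivAt A b 0) :
    ∃ H : ℂ → 𝔤, VecDifferentiableOn H (Metric.ball 0 r) ∧
      ∀ (V : Type _) [NormedAddCommGroup V] [NormedSpace ℂ V] [FiniteDimensional ℂ V]
        [LieRingModule 𝔤 V] [LieModule ℂ 𝔤 V] [CompleteSpace V] (t : ℂ),
        gauge (repCLM V D) (repCLM V (adEigenProj D (-2) (A 0))) t *
            repCLM V (N + Complex.exp t • A (Complex.exp t)) =
          (repCLM V (gaugedResidue D N (A 0) b) + Complex.exp t • repCLM V (H (Complex.exp t)) +
            Complex.exp (-t) • repCLM V (adEigenProj D (-2) (A 0))) *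
          gauge (repCLM V D) (repCLM V (adEigenProj D (-2) (A 0))) t := by
  obtain ⟨A₂, hA₂, hAA⟩ := exists_taylor_two hr hA hb
  set α := adEigenProj D (-2) (A 0) with hα
  have hαmem : α ∈ adEigenspace D (-2) := adEigenProj_mem D (-2) (A 0)
  have hx : DifferentiableOn ℂ (fun x : ℂ => x) (Metric.ball 0 r) := differentiableOn_id
  have hx2 : DifferentiableOn ℂ (fun x : ℂ => x ^ 2) (Metric.ball 0 r) := hx.pow 2
  let ad : 𝔤 →ₗ[ℂ] 𝔤 := LieAlgebra.ad ℂ 𝔤 α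
  let π : ℂ → 𝔤 →ₗ[ℂ] 𝔤 := adEigenProj D
  let c (v : 𝔤) := vecDifferentiableOn_const v (Metric.ball (0 : ℂ) r)
  -- What is left of the transformed x A(x), grouped by degree of A from -2 to 2, after splitting
  -- off the x⁻¹ α term and the residue and dividing by x. It is 𝔤-valued, so one H serves all
  -- modules.
  refine ⟨fun x => π (-2) (A₂ x) + (π (-1) b + x • π (-1) (A₂ x)) +
    (π 0 (A x) - ad (π 0 b + x • π 0 (A₂ x))) + (x • π 1 (A x) - ad (π 1 (A x))) +
    (x ^ 2 • π 2 (A x) - x • ad (π 2 (A x)) + (2⁻¹ : ℂ) • ad (ad (π 2 (A x)))),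
    ((((hA₂.map _).add ((c _).add ((hA₂.map _).smul hx))).add
      ((hA.map _).sub (((c _).add ((hA₂.map _).smul hx)).map ad))).add
      (((hA.map _).smul hx).sub ((hA.map _).map ad))).add
      ((((hA.map _).smul hx2).sub (((hA.map _).map ad).smul hx)).add
        (((((hA.map _).map ad).map ad)).smul (differentiableOn_const _))), ?_⟩
  intro V _ _ _ _ _ _ t
  set x := Complex.exp t with hxt
  have hx0 : x ≠ 0 := Complex.exp_ne_zero t
  have hxinv : Complex.exp (-t) = x⁻¹ := Complex.exp_neg t
  have hmem : ∀ c y, π c y ∈ adEigenspace D c := fun c y => adEigenProj_mem D c y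
  have hzero : ∀ {c : ℂ} {y : 𝔤}, c ∉ ({-2, -1, 0, 1, 2} : Finset ℂ) → y ∈ adEigenspace D c →
      y = 0 := fun hc hy => eq_zero_of_mem_adEigenspace hD hc hy
  have hαy : ∀ {c : ℂ} {y : 𝔤}, y ∈ adEigenspace D c → ⁅α, y⁆ ∈ adEigenspace D (-2 + c) :=
    fun hy => lie_mem_adEigenspace hαmem hy
  -- α has degree -2, so brackets of total degree below -2 vanish; this cuts off the exponential
  -- series of `ad α`.
  have hm2 : ∀ y, ⁅α, π (-2) y⁆ = 0 := fun y => hzero (by norm_num) (hαy (hmem _ y))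
  have hm1 : ∀ y, ⁅α, π (-1) y⁆ = 0 := fun y => hzero (by norm_num) (hαy (hmem _ y))
  have hm0 : ∀ y, ⁅α, ⁅α, π 0 y⁆⁆ = 0 := fun y => hzero (by norm_num) (hαy (hαy (hmem _ y)))
  have hp1 : ∀ y, ⁅α, ⁅α, π 1 y⁆⁆ = 0 := fun y => hzero (by norm_num) (hαy (hαy (hmem _ y)))
  have hp2 : ∀ y, ⁅α, ⁅α, ⁅α, π 2 y⁆⁆⁆ = 0 := fun y =>
    hzero (by norm_num) (hαy (hαy (hαy (hmem _ y))))
  -- Without this the gauge would create the pole -x⁻¹ [α, N].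
  have hαN : ⁅α, N⁆ = 0 := by rw [← lie_skew, hN α hαmem, neg_zero]
  have gN := gauge_mul_repCLM (V := V) (α := α) hDN (by rw [hαN, lie_zero, lie_zero]) t
  have g1 := gauge_mul_repCLM (V := V) (α := α) (hmem (-2) (A x)) (by simp [hm2]) t
  have g2 := gauge_mul_repCLM (V := V) (α := α) (hmem (-1) (A x)) (by simp [hm1]) t
  have g3 := gauge_mul_repCLM (V := V) (α := α) (hmem 0 (A x)) (by simp [hm0]) t
  have g4 := gauge_mul_repCLM (V := V) (α := α) (hmem 1 (A x)) (by simp [hp1]) t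
  have g5 := gauge_mul_repCLM (V := V) (α := α) (hmem 2 (A x)) (hp2 _) t
  rw [sum_five_adEigenProj hD (A x)]
  change gauge _ _ t * repCLM V (N + x • (π (-2) (A x) + π (-1) (A x) + π 0 (A x) + π 1 (A x) +
    π 2 (A x))) = _
  rw [map_add, map_smul, mul_add, mul_smul_comm]
  have e1 : Complex.exp (-2 * t) = x⁻¹ ^ 2 := by
    rw [← hxinv, ← Complex.exp_nat_mul]; push_cast; ring_nf
  have e2 : Complex.exp (-1 * t) = x⁻¹ := by rw [neg_one_mul, hxinv]
  have e3 : Complex.exp (0 * t) = 1 := by rw [zero_mul, Complex.exp_zero]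
  have e4 : Complex.exp (1 * t) = x := by rw [one_mul]
  have e5 : Complex.exp (2 * t) = x ^ 2 := by rw [hxt, ← Complex.exp_nat_mul]; push_cast; rfl
  have hAπ : ∀ c, π c (A x) = π c (A 0) + x • π c b + x ^ 2 • π c (A₂ x) := fun c => by
    rw [hAA x, map_add, map_add, map_smul, map_smul]
  have hαx : ⁅α, π 0 (A x)⁆ = ⁅α, π 0 (A 0)⁆ + x • (⁅α, π 0 b⁆ + x • ⁅α, π 0 (A₂ x)⁆) := by
    rw [hAπ, lie_add, lie_add, lie_smul, lie_smul, smul_add, smul_smul, pow_two, add_assoc]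
  rw [map_add (repCLM V), map_add (repCLM V), map_add (repCLM V), map_add (repCLM V), mul_add,
    mul_add, mul_add, mul_add, gN, g1, g2, g3, g4, g5, ← add_mul, ← add_mul, ← add_mul, ← add_mul,
    ← smul_mul_assoc, ← add_mul, ← map_add, ← map_add, ← map_add, ← map_add, ← map_smul, ← map_add,
    ← map_smul, ← map_smul, ← map_add, ← map_add]
  congr 2
  simp only [hαN, hm2, hm1, hm0, hp1, lie_zero, smul_zero, add_zero, e1, e2, e3, e4, e5, hxinv]
  change _ = gaugedResidue D N (A 0) b + x • (π (-2) (A₂ x) + (π (-1) b + x • π (-1) (A₂ x)) +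
    (π 0 (A x) - ⁅α, π 0 b + x • π 0 (A₂ x)⁆) + (x • π 1 (A x) - ⁅α, π 1 (A x)⁆) +
    (x ^ 2 • π 2 (A x) - x • ⁅α, π 2 (A x)⁆ + (2⁻¹ : ℂ) • ⁅α, ⁅α, π 2 (A x)⁆⁆)) + _
  change _ = N + π (-1) (A 0) + π (-2) b - ⁅α, π 0 (A 0)⁆ + _ + _
  have hα' : α = π (-2) (A 0) := rfl
  rw [lie_add, lie_smul, hαx, hAπ (-2), hAπ (-1), ← hα']
  match_scalars <;> field_simp

end LieGauge

/-! ### From modules to operators on normed spaces -/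

section Bridge

open NormedSpace

variable {𝔤 : Type*} [LieRing 𝔤] [LieAlgebra ℂ 𝔤]

/-- On each eigenvector the exponential is exp(2πi m) = 1; this is the single-valuedness of x^X. -/
theorem exp_two_pi_I_smul_eq_one {V : Type*} [NormedAddCommGroup V] [NormedSpace ℂ V]
    [CompleteSpace V] {X : V →L[ℂ] V}
    (h : ⨆ m : ℤ, Module.End.eigenspace (X : V →ₗ[ℂ] V) (m : ℂ) = ⊤) :
    exp ((2 * Real.pi * Complex.I) • X) = 1 := by
  have hle : ⨆ m : ℤ, Module.End.eigenspace (X : V →ₗ[ℂ] V) (m : ℂ) ≤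
      LinearMap.eqLocus (exp ((2 * Real.pi * Complex.I) • X) : V →L[ℂ] V).toLinearMap
        LinearMap.id := by
    refine iSup_le fun m v hv => ?_
    have h1 := exp_smul_apply_eigenvector (Module.End.mem_eigenspace_iff.1 hv)
      (2 * Real.pi * Complex.I)
    rw [mul_comm _ (m : ℂ), Complex.exp_int_mul_two_pi_mul_I, one_smul] at h1
    exact h1
  ext v
  exact hle (h ▸ Submodule.mem_top)

theorem exists_forall_holomorphicAt {E : Type*} [AddCommGroup E] [Module ℂ E]
    [FiniteDimensional ℂ E] {A : ℂ → E} (hA : HolomorphicAt A 0) :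
    ∃ r : ℝ, 0 < r ∧ ∀ x : ℂ, ‖x‖ < r → HolomorphicAt A x := by
  have h1 : ∀ᶠ x in nhds (0 : ℂ), ∀ i,
      AnalyticAt ℂ (fun y => (Module.finBasis ℂ E).coord i (A y)) x :=
    Filter.eventually_all.2 fun i => (hA _).eventually_analyticAt
  obtain ⟨r, hr, hr'⟩ := Metric.eventually_nhds_iff_ball.1 h1
  refine ⟨r, hr, fun x hx ℓ => ?_⟩
  have h2 : (fun y => ℓ (A y)) = fun y => ∑ i, (Module.finBasis ℂ E).coord i (A y) *
      ℓ (Module.finBasis ℂ E i) := by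
    funext y
    conv_lhs => rw [← (Module.finBasis ℂ E).sum_repr (A y), map_sum]
    simp
  rw [h2]
  exact Finset.analyticAt_fun_sum _ fun i _ => (hr' x (mem_ball_zero_iff.2 hx) i).mul analyticAt_const

theorem vecDifferentiableOn_of_holomorphicAt {E : Type*} [AddCommGroup E] [Module ℂ E] {A : ℂ → E}
    {r : ℝ} (hA : ∀ x : ℂ, ‖x‖ < r → HolomorphicAt A x) :
    VecDifferentiableOn A (Metric.ball 0 r) := fun ℓ x hx =>
  (hA x (mem_ball_zero_iff.1 hx) ℓ).differentiableAt.differentiableWithinAt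

/-- Passing to t = log x multiplies the equation by x, which turns R / x + A into R + x A. -/
theorem hasTrivialMonodromyIn_iff {V : Type*} [NormedAddCommGroup V] [NormedSpace ℂ V]
    [FiniteDimensional ℂ V] [LieRingModule 𝔤 V] [LieModule ℂ 𝔤 V] (R : 𝔤) (A : ℂ → 𝔤) :
    HasTrivialMonodromyIn R A V ↔ ∃ r : ℝ, 0 < r ∧ (∀ x : ℂ, ‖x‖ < r → HolomorphicAt A x) ∧
      AllPeriodic (fun t => repCLM V (R + Complex.exp t • A (Complex.exp t))) r := by
  have key : ∀ r Ψ, IsMultivaluedSolution R A r Ψ ↔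
      IsExpSolution (fun t => repCLM V (R + Complex.exp t • A (Complex.exp t))) r Ψ := by
    intro r Ψ
    refine forall₂_congr fun t _ => ?_
    rw [hasVecDerivAt_iff, repCLM_apply, add_lie, smul_lie, smul_neg, smul_add,
      smul_inv_smul₀ (Complex.exp_ne_zero t)]
  simp only [HasTrivialMonodromyIn, AllPeriodic, key]

theorem IsSl2Triple.map_lieEquiv {h e f : 𝔤} (t : IsSl2Triple h e f) (σ : 𝔤 ≃ₗ⁅ℂ⁆ 𝔤) :
    IsSl2Triple (σ h) (σ e) (σ f) where
  h_ne_zero := by simpa using t.h_ne_zero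
  lie_e_f := by rw [← LieEquiv.map_lie, t.lie_e_f]
  lie_h_e_nsmul := by rw [← LieEquiv.map_lie, t.lie_h_e_nsmul, map_nsmul]
  lie_h_f_nsmul := by rw [← LieEquiv.map_lie, t.lie_h_f_nsmul, map_neg, map_nsmul]

/-- A diagonalizable element with integral eigenvalues in each representation, coming from an
`sl₂`-triple. -/
theorem exp_two_pi_I_smul_repCLM {V : Type*} [NormedAddCommGroup V] [NormedSpace ℂ V]
    [FiniteDimensional ℂ V] [CompleteSpace V] [LieRingModule 𝔤 V] [LieModule ℂ 𝔤 V] {h e f : 𝔤}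
    (t : IsSl2Triple h e f) : exp ((2 * Real.pi * Complex.I) • repCLM V h) = 1 :=
  exp_two_pi_I_smul_eq_one (slTwo_iSup_eigenspace_intCast (V := V) t)

end Bridge

/-! ### Trivial monodromy and vanishing of the gauged residue -/

section Core

variable {𝔤 : Type*} [LieRing 𝔤] [LieAlgebra ℂ 𝔤] [FiniteDimensional ℂ 𝔤] {D N : 𝔤}
  (hD : ⨆ c ∈ ({-2, -1, 0, 1, 2} : Finset ℂ), adEigenspace D c = ⊤)

include hD

/-- All terms other than N have degree -1 or -2 for D, hence positive degree for -D. -/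
theorem isNilpotent_ad_gaugedResidue (hDN : N ∈ adEigenspace D 0)
    (hN : IsNilpotent (LieAlgebra.ad ℂ 𝔤 N)) (a b : 𝔤) :
    IsNilpotent (LieAlgebra.ad ℂ 𝔤 (gaugedResidue D N a b)) := by
  have hS : ⨆ c, adEigenspace (-D) c = ⊤ := by
    rw [eq_top_iff, ← hD]
    exact iSup₂_le fun c _ x hx =>
      Submodule.mem_iSup_of_mem (-c) (mem_adEigenspace_neg.2 hx)
  have hmem : ∀ {c : ℂ} {x : 𝔤}, 1 ≤ (-c).re → x ∈ adEigenspace D c →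
      x ∈ ⨆ (c : ℂ) (_ : 1 ≤ c.re), adEigenspace (-D) c := fun {c x} hc hx =>
    Submodule.mem_iSup_of_mem (-c) (Submodule.mem_iSup_of_mem hc (mem_adEigenspace_neg.2 hx))
  have h1 := lie_mem_adEigenspace (adEigenProj_mem D (-2) a) (adEigenProj_mem D 0 a)
  rw [gaugedResidue, add_assoc, add_sub_assoc]
  refine isNilpotent_ad_add hS ?_ hN ?_
  · rw [neg_lie, hDN, zero_smul, neg_zero]
  · exact sub_mem (add_mem (hmem (by norm_num) (adEigenProj_mem D (-1) a))
      (hmem (by norm_num) (adEigenProj_mem D (-2) b))) (hmem (by norm_num) h1)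

-- N has degree 0, π₋₁(a) has degree -1, and the remaining two terms have degree -2; each
-- homogeneous component must vanish separately.
omit [FiniteDimensional ℂ 𝔤] in
theorem gaugedResidue_eq_zero_iff (hDN : N ∈ adEigenspace D 0) (a b : 𝔤) :
    gaugedResidue D N a b = 0 ↔ N = 0 ∧ adEigenProj D (-1) a = 0 ∧
      adEigenProj D (-2) b = ⁅adEigenProj D (-2) a, adEigenProj D 0 a⁆ := by
  have hS : ⨆ c, adEigenspace D c = ⊤ := by
    rw [eq_top_iff, ← hD]
    exact iSup₂_le_iSup _ _
  have h1 := lie_mem_adEigenspace (adEigenProj_mem D (-2) a) (adEigenProj_mem D 0 a)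
  rw [add_zero] at h1
  constructor
  · intro h
    have hp : ∀ c, adEigenProj D c (gaugedResidue D N a b) = 0 := fun c => by rw [h, map_zero]
    simp only [gaugedResidue, map_add, map_sub] at hp
    have p0 := hp 0
    have p1 := hp (-1)
    have p2 := hp (-2)
    rw [adEigenProj_of_mem hS hDN, adEigenProj_of_mem_ne hS (by norm_num) (adEigenProj_mem D (-1) a),
      adEigenProj_of_mem_ne hS (by norm_num) (adEigenProj_mem D (-2) b),
      adEigenProj_of_mem_ne hS (by norm_num) h1, add_zero, add_zero, sub_zero] at p0
    rw [adEigenProj_of_mem_ne hS (by norm_num) hDN, adEigenProj_of_mem hS (adEigenProj_mem D (-1) a),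
      adEigenProj_of_mem_ne hS (by norm_num) (adEigenProj_mem D (-2) b),
      adEigenProj_of_mem_ne hS (by norm_num) h1, zero_add, add_zero, sub_zero] at p1
    rw [adEigenProj_of_mem_ne hS (by norm_num) hDN,
      adEigenProj_of_mem_ne hS (by norm_num) (adEigenProj_mem D (-1) a),
      adEigenProj_of_mem hS (adEigenProj_mem D (-2) b), adEigenProj_of_mem hS h1, zero_add, zero_add,
      sub_eq_zero] at p2
    exact ⟨p0, p1, p2⟩
  · rintro ⟨h0, h1, h2⟩
    rw [gaugedResidue, h0, h1, h2]
    abel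

/-- The adjoint module alone suffices: its monodromy forces the residue to act by zero, that is, to
be central, and the center is trivial. -/
theorem gaugedResidue_eq_zero_of_hasTrivialMonodromyIn [LieAlgebra.IsSemisimple ℂ 𝔤]
    (hDN : N ∈ adEigenspace D 0) (hNil : IsNilpotent (LieAlgebra.ad ℂ 𝔤 N))
    (hN : ∀ y ∈ adEigenspace D (-2), ⁅N, y⁆ = 0) {e f : 𝔤} (t : IsSl2Triple D e f)
    {A : ℂ → 𝔤} {b : 𝔤} (hb : HasVecDerivAt A b 0) (h : HasTrivialMonodromyIn (D + N) A 𝔤) :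
    gaugedResidue D N (A 0) b = 0 := by
  -- An auxiliary norm transported from coordinates; the notion of monodromy does not refer to it.
  let ε := (Module.finBasis ℂ 𝔤).equivFun
  let : NormedAddCommGroup 𝔤 := NormedAddCommGroup.induced 𝔤 (Fin (Module.finrank ℂ 𝔤) → ℂ) ε
    ε.injective
  let : NormedSpace ℂ 𝔤 := NormedSpace.induced ℂ 𝔤 (Fin (Module.finrank ℂ 𝔤) → ℂ) ε
  have : CompleteSpace 𝔤 := FiniteDimensional.complete ℂ 𝔤
  obtain ⟨r, hr, hA, hper⟩ := (hasTrivialMonodromyIn_iff (V := 𝔤) (D + N) A).1 h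
  obtain ⟨G, hG, hgauge⟩ := exists_gauge hD hDN hN hr (vecDifferentiableOn_of_holomorphicAt hA) hb
  have hper' := (allPeriodic_gauge_iff (exp_two_pi_I_smul_repCLM (V := 𝔤) t)
    (fun s _ => hgauge 𝔤 s)).1 (by simpa only [add_assoc, map_add] using hper)
  have hnil : IsNilpotent (repCLM 𝔤 (gaugedResidue D N (A 0) b)) := by
    obtain ⟨m, hm⟩ := isNilpotent_ad_gaugedResidue hD hDN hNil (A 0) b
    refine ⟨m, ?_⟩
    ext y
    have h1 : ∀ k : ℕ, (repCLM 𝔤 (gaugedResidue D N (A 0) b) ^ k) y =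
        (LieAlgebra.ad ℂ 𝔤 (gaugedResidue D N (A 0) b) ^ k) y := by
      intro k
      induction k with
      | zero => rfl
      | succ k ih => rw [pow_succ', mul_apply_eq_comp, ih, pow_succ']; rfl
    rw [h1, hm]
    rfl
  have hzero := eq_zero_of_allPeriodic hnil hr (hG.map (repCLM 𝔤)).differentiableOn hper'
  have hcenter : gaugedResidue D N (A 0) b ∈ LieAlgebra.center ℂ 𝔤 := by
    rw [LieModule.mem_maxTrivSubmodule]
    intro y
    rw [← lie_skew, ← repCLM_apply, hzero]
    simp
  rwa [LieAlgebra.center_eq_bot, LieSubmodule.mem_bot] at hcenter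

theorem hasTrivialMonodromyIn_of_gaugedResidue_eq_zero {e f : 𝔤} (t : IsSl2Triple D e f)
    {A : ℂ → 𝔤} (hA : HolomorphicAt A 0) {b : 𝔤} (hb : HasVecDerivAt A b 0)
    (h : gaugedResidue D 0 (A 0) b = 0) (V : Type*) [AddCommGroup V] [Module ℂ V]
    [FiniteDimensional ℂ V] [LieRingModule 𝔤 V] [LieModule ℂ 𝔤 V] :
    HasTrivialMonodromyIn D A V := by
  let ε := (Module.finBasis ℂ V).equivFun
  let : NormedAddCommGroup V := NormedAddCommGroup.induced V (Fin (Module.finrank ℂ V) → ℂ) ε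
    ε.injective
  let : NormedSpace ℂ V := NormedSpace.induced ℂ V (Fin (Module.finrank ℂ V) → ℂ) ε
  have : CompleteSpace V := FiniteDimensional.complete ℂ V
  obtain ⟨r, hr, hAr⟩ := exists_forall_holomorphicAt hA
  obtain ⟨G, hG, hgauge⟩ := exists_gauge hD (zero_mem (adEigenspace D 0)) (fun y _ => zero_lie y) hr
    (vecDifferentiableOn_of_holomorphicAt hAr) hb
  obtain ⟨r', hr', hr'r, hper⟩ := exists_allPeriodic hr (hG.map (repCLM V)).differentiableOn
  refine (hasTrivialMonodromyIn_iff (V := V) D A).2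
    ⟨r', hr', fun x hx => hAr x (hx.trans_le hr'r), ?_⟩
  have h1 := (allPeriodic_gauge_iff (r := r') (exp_two_pi_I_smul_repCLM (V := V) t)
    (fun s _ => hgauge V s)).2 (by simpa only [h, map_zero, zero_add] using hper)
  simpa only [zero_add, map_add] using h1

end Core

end ZeroMonodromy

/-! ### The theorem -/

open ZeroMonodromy in
theorem mainTheorem6 {𝔤 : Type*} [LieRing 𝔤] [LieAlgebra ℂ 𝔤] [FiniteDimensional ℂ 𝔤]
    [LieAlgebra.IsSimple ℂ 𝔤] (H : LieSubalgebra ℂ 𝔤) [H.IsCartanSubalgebra]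
    (hsl : ZeroMonodromy.IsSimplyLaced (LieAlgebra.IsKilling.rootSystem H))
    (B : (LieAlgebra.IsKilling.rootSystem H).Base)
    (θ : H.root) (hθ : ZeroMonodromy.IsHighestRoot B θ)
    (θv : 𝔤) (hθv : θv = ((LieAlgebra.IsKilling.rootSystem H).coroot θ : H))
    (η₀ η₁ η₂ : 𝔤)
    (hη₀ : η₀ ∈ ZeroMonodromy.adEigenspace θv 0 ⊓ ZeroMonodromy.nPlus B)
    (hη₁ : η₁ ∈ ZeroMonodromy.adEigenspace θv 1)
    (hη₂ : η₂ ∈ ZeroMonodromy.adEigenspace θv 2)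
    (A : ℂ → 𝔤) (hA : ZeroMonodromy.HolomorphicAt A 0)
    (a b : 𝔤) (ha : A 0 = a) (hb : ZeroMonodromy.HasVecDerivAt A b 0)
    (π : ℂ → 𝔤 →ₗ[ℂ] 𝔤) (hπ : π = ZeroMonodromy.adEigenProj (-θv + η₁ + η₂)) :
    ZeroMonodromy.HasTrivialMonodromy (-θv + η₀ + η₁ + η₂) A ↔
      η₀ = 0 ∧ π (-1) a = 0 ∧ π (-2) b = ⁅π (-2) a, π 0 a⁆ := by
  have hθv' : θv = ((LieAlgebra.IsKilling.coroot θ.1 : H) : 𝔤) := hθv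
  have hgr : ⨆ c ∈ ({-2, -1, 0, 1, 2} : Finset ℂ), adEigenspace θv c = ⊤ :=
    hθv' ▸ iSup_adEigenspace_coroot hsl θ
  have hnil := isNilpotent_ad_of_mem_nPlus B hη₀.2
  have hkill : ∀ y ∈ adEigenspace θv 2, ⁅η₀, y⁆ = 0 := fun y hy =>
    lie_eq_zero_of_mem_adEigenspace_coroot_two hsl θ hnil (hθv' ▸ hη₀.1) (hθv' ▸ hy)
  obtain ⟨σ, hσ⟩ := exists_conj_residue hgr hη₀.1 hnil hkill hη₁ hη₂
  obtain ⟨e, f, t⟩ := exists_isSl2Triple_coroot θ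
  rw [← hθv'] at t
  -- Reversing the triple of θ replaces θ^∨ by -θ^∨, so σ(-θ^∨) is again the semisimple element of
  -- an sl₂-triple.
  have tD := IsSl2Triple.map_lieEquiv t.symm σ
  have hgr' : ⨆ c ∈ ({-2, -1, 0, 1, 2} : Finset ℂ), adEigenspace (-θv) c = ⊤ := by
    rw [eq_top_iff, ← hgr]
    refine iSup₂_le fun c hc x hx => Submodule.mem_iSup_of_mem (-c)
      (Submodule.mem_iSup_of_mem ?_ (mem_adEigenspace_neg.2 hx))
    simp only [Finset.mem_insert, Finset.mem_singleton] at hc ⊢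
    rcases hc with rfl | rfl | rfl | rfl | rfl <;> norm_num
  have hD := iSup_adEigenspace_map σ hgr'
  subst hπ ha
  have hDN : σ η₀ ∈ adEigenspace (σ (-θv)) 0 := by
    rw [map_mem_adEigenspace_iff, ← neg_zero, mem_adEigenspace_neg]
    exact hη₀.1
  -- The criterion is obtained for the projections of σ(-θ^∨), which depends on η₀ through σ. They
  -- agree with π once η₀ = 0, so each direction settles η₀ = 0 before the other two conditions.
  have hDeq : η₀ = 0 → σ (-θv) = -θv + η₁ + η₂ := by
    rintro rfl
    rwa [add_zero] at hσ
  have hiff := gaugedResidue_eq_zero_iff hD hDN (A 0) b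
  constructor
  · intro h
    have hres : gaugedResidue (σ (-θv)) (σ η₀) (A 0) b = 0 := by
      refine gaugedResidue_eq_zero_of_hasTrivialMonodromyIn hD hDN ?_ ?_ tD hb ?_
      · obtain ⟨m, hm⟩ := hnil
        refine ⟨m, ?_⟩
        have hpow : ∀ (k : ℕ) (y : 𝔤), (LieAlgebra.ad ℂ 𝔤 (σ η₀) ^ k) (σ y) =
            σ ((LieAlgebra.ad ℂ 𝔤 η₀ ^ k) y) := by
          intro k y
          induction k with
          | zero => rfl
          | succ k ih =>
            rw [pow_succ', Module.End.mul_apply, ih, pow_succ', Module.End.mul_apply,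
              LieAlgebra.ad_apply, LieAlgebra.ad_apply, LieEquiv.map_lie]
        ext y
        obtain ⟨z, rfl⟩ : ∃ z, σ z = y := ⟨σ.symm y, σ.apply_symm_apply y⟩
        rw [hpow, hm, LinearMap.zero_apply, LinearMap.zero_apply, map_zero]
      · intro y hy
        obtain ⟨z, rfl⟩ : ∃ z, σ z = y := ⟨σ.symm y, σ.apply_symm_apply y⟩
        rw [map_mem_adEigenspace_iff, mem_adEigenspace_neg] at hy
        rw [← LieEquiv.map_lie, hkill z hy, map_zero]
      · rw [← map_add, hσ]
        exact h 𝔤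
    obtain ⟨h0, h1⟩ := hiff.1 hres
    have h0' : η₀ = 0 := by simpa using h0
    rw [hDeq h0'] at h1
    exact ⟨h0', h1⟩
  · rintro ⟨h0, h1⟩ V _ _ _ _ _
    have hres := hiff.2 ⟨by rw [h0, map_zero], by rwa [hDeq h0]⟩
    rw [h0, map_zero] at hres
    have := hasTrivialMonodromyIn_of_gaugedResidue_eq_zero hD tD hA hb hres V
    rw [hDeq h0] at this
    rwa [h0, add_zero]
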